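/- Let $M$ be any model of Quine's set theory NF, i.e. a nonempty set with a binary relation $\in$ that satisfies extensionality and the comprehension axiom $\forall\vec x\,\exists y\,\forall z\,(z\in y\leftrightarrow\Phi(\vec x,z))$ for every stratifiable formula $\Phi$ of the language of set theory ($y$ not free in $\Phi$). (A formula is stratifiable if natural numbers can be assigned to its variables, free and bound, so that $\sigma(u)=\sigma(v)$ whenever $u=v$ occurs in it and $\sigma(u)+1=\sigma(v)$ whenever $u\in v$ occurs in it.) The category $\mathbf N$ of NF sets has as objects the sets (elements) of $M$, and as arrows $A\to B$ the functions from the members of $A$ to the members of $B$ whose graph is a set of $M$; composition is composition of functions. Theorem. $\mathbf N$ is a category of classes, that is: (i) $\mathbf N$ has finite limits and finite coproducts; (ii) $\mathbf N$ has kernel quotients (every kernel pair has a coequalizer), and regular epimorphisms in $\mathbf N$ are stable under pullback; (iii) $\mathbf N$ has dual images: for every arrow $f:C\to D$ the pullback functor $f^*:\mathrm{Sub}(D)\to\mathrm{Sub}(C)$ has a right adjoint $\forall_f:\mathrm{Sub}(C)\to\mathrm{Sub}(D)$. -/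

import Mathlib

universe u

open CategoryTheory CategoryTheory.Limits

namespace NewFoundations

/-- First-order formulas in the language of set theory, with variables named by natural numbers. -/
inductive SetFormula : Type
  | eq (i j : ℕ)
  | mem (i j : ℕ)
  | neg (φ : SetFormula)
  | and (φ ψ : SetFormula)
  | or (φ ψ : SetFormula)
  | imp (φ ψ : SetFormula)
  | iff (φ ψ : SetFormula)
  | all (i : ℕ) (φ : SetFormula)
  | ex (i : ℕ) (φ : SetFormula)

namespace SetFormula

/-- `φ.IsStratifiedBy σ`: the assignment `σ` of natural numbers to the variables (free or bound)
is a stratification of `φ`, that is, `σ i = σ j` whenever `vᵢ = vⱼ` occurs in `φ` and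
`σ i + 1 = σ j` whenever `vᵢ ∈ vⱼ` occurs in `φ`. -/
def IsStratifiedBy (σ : ℕ → ℕ) : SetFormula → Prop
  | eq i j => σ i = σ j
  | mem i j => σ i + 1 = σ j
  | neg φ => φ.IsStratifiedBy σ
  | and φ ψ => φ.IsStratifiedBy σ ∧ ψ.IsStratifiedBy σ
  | or φ ψ => φ.IsStratifiedBy σ ∧ ψ.IsStratifiedBy σ
  | imp φ ψ => φ.IsStratifiedBy σ ∧ ψ.IsStratifiedBy σ
  | iff φ ψ => φ.IsStratifiedBy σ ∧ ψ.IsStratifiedBy σ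
  | all _ φ => φ.IsStratifiedBy σ
  | ex _ φ => φ.IsStratifiedBy σ

/-- A formula is stratifiable if it has a stratification. -/
def Stratifiable (φ : SetFormula) : Prop := ∃ σ : ℕ → ℕ, φ.IsStratifiedBy σ

/-- Tarskian satisfaction of a formula in the structure `(M, E)` under the valuation `v`. -/
def Sat {M : Type u} (E : M → M → Prop) : SetFormula → (ℕ → M) → Prop
  | eq i j, v => v i = v j
  | mem i j, v => E (v i) (v j)
  | neg φ, v => ¬ φ.Sat E v
  | and φ ψ, v => φ.Sat E v ∧ ψ.Sat E v
  | or φ ψ, v => φ.Sat E v ∨ ψ.Sat E v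
  | imp φ ψ, v => φ.Sat E v → ψ.Sat E v
  | iff φ ψ, v => φ.Sat E v ↔ ψ.Sat E v
  | all i φ, v => ∀ x : M, φ.Sat E (Function.update v i x)
  | ex i φ, v => ∃ x : M, φ.Sat E (Function.update v i x)

end SetFormula

/-- A model of Quine's New Foundations: a nonempty structure with one binary relation satisfying
extensionality and every stratifiable instance of comprehension. In the latter, the valuation
`v` supplies the parameters and `i` is the variable that is abstracted. -/
class NFModel (M : Type u) where
  mem : M → M → Prop
  nonempty : Nonempty M
  extensionality : ∀ x y : M, (∀ z, mem z x ↔ mem z y) → x = y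
  comprehension : ∀ φ : SetFormula, φ.Stratifiable → ∀ (v : ℕ → M) (i : ℕ),
    ∃ y : M, ∀ z : M, mem z y ↔ φ.Sat mem (Function.update v i z)

section

variable {M : Type u} [NFModel M]

/-- `z` is the (Wiener-Kuratowski) ordered pair `{{a}, {a, b}}`. -/
def IsPair (z a b : M) : Prop :=
  ∀ w : M, NFModel.mem w z ↔
    ((∀ t : M, NFModel.mem t w ↔ t = a) ∨ (∀ t : M, NFModel.mem t w ↔ (t = a ∨ t = b)))

theorem exists_unordered (a b : M) : ∃ w : M, ∀ t : M, NFModel.mem t w ↔ (t = a ∨ t = b) := by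
  obtain ⟨y, hy⟩ := NFModel.comprehension (M := M)
    (.or (.eq 0 1) (.eq 0 2)) ⟨fun _ => 0, by simp [SetFormula.IsStratifiedBy]⟩
    (fun n => if n = 1 then a else b) 0
  exact ⟨y, fun t => by simpa [SetFormula.Sat, Function.update] using hy t⟩

theorem exists_pair (a b : M) : ∃ z : M, IsPair z a b := by
  obtain ⟨s, hs⟩ := exists_unordered a a
  obtain ⟨d, hd⟩ := exists_unordered a b
  obtain ⟨z, hz⟩ := exists_unordered s d
  refine ⟨z, fun w => (hz w).trans ⟨?_, ?_⟩⟩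
  · rintro (rfl | rfl)
    · left; simpa using hs
    · right; exact hd
  · rintro (h | h)
    · left; exact NFModel.extensionality _ _ fun t => by rw [h, hs]; simp
    · right; exact NFModel.extensionality _ _ fun t => by rw [h, hd]

theorem IsPair.unique {z z' a b : M} (h : IsPair z a b) (h' : IsPair z' a b) : z = z' :=
  NFModel.extensionality _ _ fun w => (h w).trans (h' w).symm

theorem IsPair.inj {z a b a' b' : M} (h : IsPair z a b) (h' : IsPair z a' b') :
    a = a' ∧ b = b' := by
  have key : ∀ {a b a' b' : M}, IsPair z a b → IsPair z a' b' → a = a' ∧ (b = a' ∨ b = b') := by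
    intro a b a' b' h h'
    obtain ⟨s, hs⟩ := exists_unordered a a
    obtain ⟨d, hd⟩ := exists_unordered a b
    have h1 := (h' s).1 ((h s).2 (Or.inl (by simpa using hs)))
    have h2 := (h' d).1 ((h d).2 (Or.inr hd))
    refine ⟨?_, ?_⟩
    · rcases h1 with h1 | h1
      · exact (h1 a).1 ((hs a).2 (Or.inl rfl))
      · have := (hs a').1 ((h1 a').2 (Or.inl rfl))
        simpa [eq_comm] using this
    · rcases h2 with h2 | h2
      · exact Or.inl ((h2 b).1 ((hd b).2 (Or.inr rfl)))
      · exact (h2 b).1 ((hd b).2 (Or.inr rfl))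
  obtain ⟨h1, h2⟩ := key h h'
  obtain ⟨_, h3⟩ := key h' h
  refine ⟨h1, ?_⟩
  subst h1
  rcases h2 with h2 | h2
  · rcases h3 with h3 | h3
    · rw [h2, h3]
    · exact h3.symm
  · exact h2

/-- The formula expressing `IsPair v_z v_a v_b`, with auxiliary bound variables `w` and `t`. -/
def pairFormula (z a b w t : ℕ) : SetFormula :=
  .all w (.iff (.mem w z)
    (.or (.all t (.iff (.mem t w) (.eq t a)))
      (.all t (.iff (.mem t w) (.or (.eq t a) (.eq t b))))))

end

/-- The objects of the category of NF sets: all the elements of the model, i.e. all its sets. -/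
@[ext]
structure NFSet (M : Type u) where
  carrier : M

namespace NFSet

variable {M : Type u} [NFModel M]

/-- The members of a set of the model. -/
def Elem (A : NFSet M) : Type u := {x : M // NFModel.mem x A.carrier}

/-- The graph `{⟨a, f(a)⟩ | a ∈ A}` of the map `f` is a set of the model. -/
def HasGraph {A B : NFSet M} (f : A.Elem → B.Elem) : Prop :=
  ∃ g : M, ∀ z : M, NFModel.mem z g ↔ ∃ a : A.Elem, IsPair z a.1 (f a).1

theorem hasGraph_id (A : NFSet M) : HasGraph (id : A.Elem → A.Elem) := by
  obtain ⟨g, hg⟩ := NFModel.comprehension (M := M)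
    (.ex 2 (.and (.mem 2 1) (pairFormula 0 2 2 3 4)))
    ⟨fun n => if n = 0 then 2 else if n = 1 then 1 else if n = 3 then 1 else 0, by
      simp [pairFormula, SetFormula.IsStratifiedBy]⟩
    (fun _ => A.carrier) 0
  refine ⟨g, fun z => (hg z).trans ?_⟩
  simp [pairFormula, SetFormula.Sat, Function.update, IsPair, Elem]

theorem hasGraph_comp {A B C : NFSet M} {f : A.Elem → B.Elem} {h : B.Elem → C.Elem}
    (hf : HasGraph f) (hh : HasGraph h) : HasGraph (h ∘ f) := by
  obtain ⟨F, hF⟩ := hf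
  obtain ⟨H, hH⟩ := hh
  obtain ⟨g, hg⟩ := NFModel.comprehension (M := M)
    (.ex 3 (.ex 4 (.ex 5 (.and (pairFormula 0 3 5 8 9)
      (.and (.ex 6 (.and (.mem 6 1) (pairFormula 6 3 4 8 9)))
        (.ex 7 (.and (.mem 7 2) (pairFormula 7 4 5 8 9))))))))
    ⟨fun n => if n = 0 then 2 else if n = 1 then 3 else if n = 2 then 3 else
      if n = 6 then 2 else if n = 7 then 2 else if n = 8 then 1 else 0, by
      simp [pairFormula, SetFormula.IsStratifiedBy]⟩
    (fun n => if n = 1 then F else H) 0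
  have hg' : ∀ z, NFModel.mem z g ↔ ∃ a b c : M, IsPair z a c ∧
      (∃ p, NFModel.mem p F ∧ IsPair p a b) ∧ (∃ q, NFModel.mem q H ∧ IsPair q b c) := by
    intro z
    refine (hg z).trans ?_
    simp [pairFormula, SetFormula.Sat, Function.update, IsPair]
  refine ⟨g, fun z => (hg' z).trans ⟨?_, ?_⟩⟩
  · rintro ⟨a, b, c, hz, ⟨p, hp, hpab⟩, ⟨q, hq, hqbc⟩⟩
    obtain ⟨a', ha'⟩ := (hF p).1 hp
    obtain ⟨b', hb'⟩ := (hH q).1 hq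
    obtain ⟨h1, h2⟩ := hpab.inj ha'
    obtain ⟨h3, h4⟩ := hqbc.inj hb'
    have h5 : f a' = b' := Subtype.ext (h2.symm.trans h3)
    refine ⟨a', ?_⟩
    rw [Function.comp, h5, ← h4, ← h1]
    exact hz
  · rintro ⟨a, hz⟩
    obtain ⟨p, hp⟩ := exists_pair a.1 (f a).1
    obtain ⟨q, hq⟩ := exists_pair (f a).1 (h (f a)).1
    exact ⟨a.1, (f a).1, (h (f a)).1, hz, ⟨p, (hF p).2 ⟨a, hp⟩, hp⟩,
      ⟨q, (hH q).2 ⟨f a, hq⟩, hq⟩⟩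

/-- The category of NF sets: the objects are the sets of the model, and an arrow `A ⟶ B` is a
function from the members of `A` to the members of `B` whose graph is a set of the model. -/
instance : Category.{u} (NFSet M) where
  Hom A B := {f : A.Elem → B.Elem // HasGraph f}
  id A := ⟨id, hasGraph_id A⟩
  comp f g := ⟨g.1 ∘ f.1, hasGraph_comp f.2 g.2⟩

end NFSet

/-- A category of classes. -/
class CategoryOfClasses (C : Type*) [Category C] : Prop
    extends HasFiniteLimits C where
  finiteCoproducts : HasFiniteCoproducts C
  /-- `C` has kernel quotients: the kernel pair of every arrow has a coequalizer. -/
  kernelQuotients : ∀ {X Y Z : C} {f : X ⟶ Y} {p q : Z ⟶ X},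
    IsKernelPair f p q → HasCoequalizer p q
  /-- Regular epimorphisms are stable under pullback. -/
  regularEpi_stable : (MorphismProperty.regularEpi C).IsStableUnderBaseChange
  /-- `C` has dual images: for every arrow `f : X ⟶ Y`, the pullback functor
  `Sub(Y) ⥤ Sub(X)` has a right adjoint. -/
  dualImages : ∀ {X Y : C} (f : X ⟶ Y), (Subobject.pullback f).IsLeftAdjoint

end NewFoundations

namespace NewFoundations

/-! ### A shallow embedding of stratified formulas -/

/-! A functional relation from A to B gives an arrow as soon as it is stratified with argument and
value of the same type. Most of the usual constructions meet this condition as they stand: images,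
descent along surjections, and dual images {b ∈ B | every a over b lies in P}. Kernel quotients need
no sets of equivalence classes, where x ↦ [x] would raise the type: the coequalizer of the kernel
pair of f is the surjection of f onto its image. So regular epimorphisms are the surjections, and
these are stable because a pullback has an element over every compatible pair.

The exception is pairing. A Kuratowski pair lies two types above its components, so its projections
are not stratified as arrows. Pullbacks and coproducts use Quine's type-level pair instead, which
needs an internal injection of the universe V into itself that misses an element. This is Specker's
theorem, `not_dedekindFinite`.

Suppose V were Dedekind finite. Then any two sets are comparable under embedding, every nonempty
family has a least member, and the exponential |USC y| ↦ |P y| is injective and strictly increasing.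
(Equinumerosity means mutual embedding throughout.) Let C consist of the sets at even distance,
along this map, from a set that is not a power set. The exponential exchanges C and its complement,
while USC preserves C because USC (P y) ~ P (USC y). Since P V = V, exactly one of USC V and V lies
in C; as USC preserves C, it is USC V. Now V, outside C, is equinumerous with some P w, where USC w
∈ C. Then USC (USC w) ∈ C, so P (USC w) ∉ C; but P (USC w) ~ USC (P w) ~ USC V ∈ C, a contradiction.
-/

/-- The universe of a model, regarded as the range of the variables of type `k`. -/
def Typed (M : Type u) (_ : ℕ) : Type u := M

/-- The element `m` of the model, used as a parameter of type `k`. -/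
def up {M : Type u} (k : ℕ) (m : M) : Typed M k := m

/-- Formulas with parameters which are stratified by construction: a variable is a pair of a
number and a type. -/
inductive TypedFormula (M : Type u) : Type u
  | eq (t : ℕ) (a b : ℕ ⊕ M)
  | mem (t : ℕ) (a b : ℕ ⊕ M)
  | neg (φ : TypedFormula M)
  | and (φ ψ : TypedFormula M)
  | all (i t : ℕ) (φ : TypedFormula M)

namespace TypedFormula

variable {M : Type u}

def val (e : ℕ × ℕ → M) (t : ℕ) : ℕ ⊕ M → M
  | .inl i => e (i, t)
  | .inr m => m

def Sat (R : M → M → Prop) : TypedFormula M → (ℕ × ℕ → M) → Prop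
  | eq t a b, e => val e t a = val e t b
  | mem t a b, e => R (val e t a) (val e (t + 1) b)
  | neg φ, e => ¬ φ.Sat R e
  | and φ ψ, e => φ.Sat R e ∧ ψ.Sat R e
  | all i t φ, e => ∀ x : M, φ.Sat R (Function.update e (i, t) x)

def paramsOf : ℕ ⊕ M → List M
  | .inl _ => []
  | .inr m => [m]

def params : TypedFormula M → List M
  | eq _ a b => paramsOf a ++ paramsOf b
  | mem _ a b => paramsOf a ++ paramsOf b
  | neg φ => φ.params
  | and φ ψ => φ.params ++ ψ.params
  | all _ _ φ => φ.params

/-- The variable coding a term of type `t`, given a numbering of the parameters. -/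
def code (idx : M → ℕ) (t : ℕ) : ℕ ⊕ M → ℕ
  | .inl i => 2 * Nat.pair i t
  | .inr m => 2 * Nat.pair (idx m) t + 1

def toSetFormula (idx : M → ℕ) : TypedFormula M → SetFormula
  | eq t a b => .eq (code idx t a) (code idx t b)
  | mem t a b => .mem (code idx t a) (code idx (t + 1) b)
  | neg φ => .neg (φ.toSetFormula idx)
  | and φ ψ => .and (φ.toSetFormula idx) (ψ.toSetFormula idx)
  | all i t φ => .all (2 * Nat.pair i t) (φ.toSetFormula idx)

theorem unpair_code (idx : M → ℕ) (t : ℕ) (a : ℕ ⊕ M) :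
    (code idx t a / 2).unpair.2 = t := by
  cases a with
  | inl i => simp [code]
  | inr m =>
    rw [code, show (2 * Nat.pair (idx m) t + 1) / 2 = Nat.pair (idx m) t by omega]
    simp

theorem toSetFormula_stratifiable (idx : M → ℕ) (φ : TypedFormula M) :
    (φ.toSetFormula idx).Stratifiable := by
  -- Halving drops the bit that tells variables from parameters; the second component of the pairing
  -- is the type.
  refine ⟨fun n => (n / 2).unpair.2, ?_⟩
  induction φ with
  | eq t a b => simp [toSetFormula, SetFormula.IsStratifiedBy, unpair_code]
  | mem t a b => simp [toSetFormula, SetFormula.IsStratifiedBy, unpair_code]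
  | neg φ ih => exact ih
  | and φ ψ ih ih' => exact ⟨ih, ih'⟩
  | all i t φ ih => exact ih

theorem apply_code {idx : M → ℕ} {t : ℕ} {a : ℕ ⊕ M} {v : ℕ → M} {e : ℕ × ℕ → M}
    (h : ∀ i t, v (2 * Nat.pair i t) = e (i, t))
    (h' : ∀ m ∈ paramsOf a, ∀ t, v (2 * Nat.pair (idx m) t + 1) = m) :
    v (code idx t a) = val e t a := by
  cases a with
  | inl i => exact h i t
  | inr m => exact h' m (by simp [paramsOf]) t

/-- Parity keeps variables and parameters apart, so binding a variable never touches a parameter. A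
parameter has a separate variable at each type, all with the same value, so one formula may use it
at several types. -/
theorem sat_toSetFormula (R : M → M → Prop) (idx : M → ℕ) (φ : TypedFormula M) :
    ∀ (v : ℕ → M) (e : ℕ × ℕ → M), (∀ i t, v (2 * Nat.pair i t) = e (i, t)) →
      (∀ m ∈ φ.params, ∀ t, v (2 * Nat.pair (idx m) t + 1) = m) →
      ((φ.toSetFormula idx).Sat R v ↔ φ.Sat R e) := by
  induction φ with
  | eq t a b =>
    intro v e h h'
    simp only [toSetFormula, SetFormula.Sat, Sat]
    rw [apply_code h fun m hm => h' m (List.mem_append_left _ hm),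
      apply_code h fun m hm => h' m (List.mem_append_right _ hm)]
  | mem t a b =>
    intro v e h h'
    simp only [toSetFormula, SetFormula.Sat, Sat]
    rw [apply_code h fun m hm => h' m (List.mem_append_left _ hm),
      apply_code h fun m hm => h' m (List.mem_append_right _ hm)]
  | neg φ ih => exact fun v e h h' => not_congr (ih v e h h')
  | and φ ψ ih ih' =>
    exact fun v e h h' => and_congr (ih v e h fun m hm => h' m (List.mem_append_left _ hm))
      (ih' v e h fun m hm => h' m (List.mem_append_right _ hm))
  | all i t φ ih =>
    refine fun v e h h' => forall_congr' fun x => ih _ _ (fun j s => ?_) fun m hm s => ?_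
    · by_cases hj : (j, s) = (i, t)
      · obtain ⟨rfl, rfl⟩ := Prod.mk.inj hj
        simp
      · rw [Function.update_of_ne hj, Function.update_of_ne, h]
        intro hc
        exact hj (by simpa [Nat.pair_eq_pair] using hc)
    · rw [Function.update_of_ne (by omega)]
      exact h' m hm s

end TypedFormula

/-! ### Finding stratified formulas by instance search -/

/-- A context of typed variables, with its interpretation as a valuation. -/
class Context (M : Type u) (α : Type u) where
  depth : ℕ
  valuation : α → ℕ × ℕ → M

noncomputable instance Context.empty (M : Type u) [NFModel M] : Context M PUnit.{u + 1} where
  depth := 0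
  valuation _ _ := Classical.choice NFModel.nonempty

/-- Variables are numbered by de Bruijn level: the new one takes the old depth as its number, so
earlier numbers stay valid as the context grows. -/
noncomputable instance Context.cons (M : Type u) (α : Type u) [Context M α] (k : ℕ) :
    Context M (α × Typed M k) where
  depth := Context.depth M α + 1
  valuation a := Function.update (Context.valuation a.1) (Context.depth M α, k) a.2

section

variable {M : Type u} [NFModel M] {α β : Type u} [Context M α] [Context M β]

variable (M) in
/-- `g` is the projection of a context to an initial segment of it. -/
class IsProjection (g : α → β) : Prop where
  le : Context.depth M β ≤ Context.depth M α
  eq : ∀ a p, p.1 < Context.depth M β →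
    Context.valuation (M := M) a p = Context.valuation (g a) p

instance IsProjection.id : IsProjection M (fun a : α => a) := ⟨le_rfl, fun _ _ _ => rfl⟩

instance IsProjection.fst {k : ℕ} (g : α → β × Typed M k) [h : IsProjection M g] :
    IsProjection M (fun a => (g a).1) where
  le := (Nat.le_succ _).trans h.le
  eq a p hp := by
    rw [h.eq a p (Nat.lt_succ_of_lt hp)]
    refine Function.update_of_ne ?_ _ _
    rintro rfl
    exact lt_irrefl _ hp

/-- `f` is a variable or a parameter. -/
class IsTerm {k : ℕ} (f : α → Typed M k) : Prop where
  out : (∃ i < Context.depth M α, ∀ a, Context.valuation (M := M) a (i, k) = f a) ∨ ∃ m : M, ∀ a, f a = m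

instance IsTerm.param (k : ℕ) (m : M) : IsTerm (fun _ : α => up k m) := ⟨.inr ⟨m, fun _ => rfl⟩⟩

instance IsTerm.snd {k : ℕ} (g : α → β × Typed M k) [h : IsProjection M g] :
    IsTerm (fun a => (g a).2) where
  out := by
    refine .inl ⟨Context.depth M β, h.le, fun a => ?_⟩
    rw [h.eq a _ (Nat.lt_succ_self _)]
    exact Function.update_self ..

instance (priority := low) IsTerm.comp {k : ℕ} (f : β → Typed M k) [hf : IsTerm f] (g : α → β)
    [h : IsProjection M g] : IsTerm (fun a => f (g a)) where
  out := by
    obtain ⟨i, hi, hf⟩ | ⟨m, hm⟩ := hf.out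
    · exact .inl ⟨i, hi.trans_le h.le, fun a => (h.eq a _ hi).trans (hf _)⟩
    · exact .inr ⟨m, fun a => hm _⟩

omit [NFModel M] in
theorem IsTerm.exists_eq {k : ℕ} (f : α → Typed M k) [hf : IsTerm f] :
    ∃ x : ℕ ⊕ M, ∀ a, TypedFormula.val (Context.valuation a) k x = f a := by
  obtain ⟨i, -, h⟩ | ⟨m, h⟩ := hf.out
  · exact ⟨.inl i, h⟩
  · exact ⟨.inr m, fun a => (h a).symm⟩

variable (M) in
/-- The predicate `P` is expressed by a stratified formula. -/
class Stratified (P : α → Prop) : Prop where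
  out : ∃ φ : TypedFormula M, ∀ a, φ.Sat NFModel.mem (Context.valuation a) ↔ P a

namespace Stratified

instance eq {k : ℕ} (f g : α → Typed M k) [hf : IsTerm f] [hg : IsTerm g] :
    Stratified M (fun a => f a = g a) where
  out := by
    obtain ⟨x, hx⟩ := IsTerm.exists_eq f
    obtain ⟨y, hy⟩ := IsTerm.exists_eq g
    exact ⟨.eq k x y, fun a => by rw [TypedFormula.Sat, hx, hy]; rfl⟩

instance mem {k : ℕ} (f : α → Typed M k) (g : α → Typed M (k + 1)) [hf : IsTerm f]
    [hg : IsTerm g] : Stratified M (fun a => NFModel.mem (M := M) (f a) (g a)) where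
  out := by
    obtain ⟨x, hx⟩ := IsTerm.exists_eq f
    obtain ⟨y, hy⟩ := IsTerm.exists_eq g
    exact ⟨.mem k x y, fun a => by rw [TypedFormula.Sat, hx, hy]⟩

instance not (P : α → Prop) [hP : Stratified M P] : Stratified M (fun a => ¬ P a) where
  out := by
    obtain ⟨φ, hφ⟩ := hP.out
    exact ⟨.neg φ, fun a => not_congr (hφ a)⟩

instance and (P Q : α → Prop) [hP : Stratified M P] [hQ : Stratified M Q] :
    Stratified M (fun a => P a ∧ Q a) where
  out := by
    obtain ⟨φ, hφ⟩ := hP.out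
    obtain ⟨ψ, hψ⟩ := hQ.out
    exact ⟨.and φ ψ, fun a => and_congr (hφ a) (hψ a)⟩

theorem congr {P Q : α → Prop} (h : Stratified M P) (hPQ : ∀ a, P a ↔ Q a) : Stratified M Q := by
  obtain ⟨φ, hφ⟩ := h.out
  exact ⟨φ, fun a => (hφ a).trans (hPQ a)⟩

instance or (P Q : α → Prop) [hP : Stratified M P] [hQ : Stratified M Q] :
    Stratified M (fun a => P a ∨ Q a) :=
  congr (P := fun a => ¬ (¬ P a ∧ ¬ Q a)) inferInstance fun a => by tauto

instance imp (P Q : α → Prop) [hP : Stratified M P] [hQ : Stratified M Q] :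
    Stratified M (fun a => P a → Q a) :=
  congr (P := fun a => ¬ (P a ∧ ¬ Q a)) inferInstance fun a => by tauto

instance iff (P Q : α → Prop) [hP : Stratified M P] [hQ : Stratified M Q] :
    Stratified M (fun a => P a ↔ Q a) :=
  congr (P := fun a => (P a → Q a) ∧ (Q a → P a)) inferInstance fun a => by tauto

instance all {k : ℕ} (P : α → Typed M k → Prop)
    [hP : Stratified M (fun a : α × Typed M k => P a.1 a.2)] :
    Stratified M (fun a => ∀ x, P a x) where
  out := by
    obtain ⟨φ, hφ⟩ := hP.out
    exact ⟨.all (Context.depth M α) k φ, fun a => forall_congr' fun x => hφ (a, x)⟩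

instance ex {k : ℕ} (P : α → Typed M k → Prop)
    [hP : Stratified M (fun a : α × Typed M k => P a.1 a.2)] :
    Stratified M (fun a => ∃ x, P a x) :=
  congr (P := fun a => ¬ ∀ x, ¬ P a x) inferInstance fun a => by simp

end Stratified

variable (M) in
-- Comprehension for an ordinary predicate: its quantifiers range over `Typed M k`, and instance
-- search supplies the stratified formula.
theorem exists_set {k : ℕ} (P : Typed M k → Prop)
    [h : Stratified M (fun a : PUnit.{u + 1} × Typed M k => P a.2)] :
    ∃ y : M, ∀ z : M, NFModel.mem z y ↔ P z := by
  classical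
  obtain ⟨φ, hφ⟩ := h.out
  let L := φ.params
  let c : M := Classical.choice NFModel.nonempty
  obtain ⟨y, hy⟩ := NFModel.comprehension (φ.toSetFormula L.idxOf)
    (φ.toSetFormula_stratifiable _)
    -- Odd variables look their parameter up in `L`; the default `c` for the others is arbitrary.
    -- The abstracted variable has number 0, the depth of the empty context.
    (fun n => if n % 2 = 0 then c else L.getD (n / 2).unpair.1 c) (2 * Nat.pair 0 k)
  refine ⟨y, fun z => (hy z).trans ((TypedFormula.sat_toSetFormula _ _ φ _ _ ?_ ?_).trans
    (hφ (⟨⟩, z)))⟩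
  · intro i t
    by_cases hi : (i, t) = (0, k)
    · obtain ⟨rfl, rfl⟩ := Prod.mk.inj hi
      simp only [Function.update_self]
      exact (Function.update_self (β := fun _ => M) (0, t) z _).symm
    · rw [Function.update_of_ne (fun hc => hi (by simpa [Nat.pair_eq_pair] using hc))]
      refine Eq.trans ?_ (Function.update_of_ne (β := fun _ => M) hi z _).symm
      simp only [Nat.mul_mod_right, if_true]
      rfl
  · intro m hm t
    rw [Function.update_of_ne (by omega), if_neg (by omega),
      show (2 * Nat.pair (L.idxOf m) t + 1) / 2 = Nat.pair (L.idxOf m) t by omega]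
    have := List.idxOf_lt_length_iff.2 hm
    simp [L, this]

/-! ### Relations that are sets -/

instance Stratified.isPair {k : ℕ} (z : α → Typed M (k + 2)) (x y : α → Typed M k) [IsTerm z]
    [IsTerm x] [IsTerm y] : Stratified M (fun a => IsPair (M := M) (z a) (x a) (y a)) :=
  inferInstanceAs (Stratified M (fun a => ∀ w : Typed M (k + 1),
    NFModel.mem (M := M) w (z a) ↔ ((∀ t : Typed M k, NFModel.mem (M := M) t w ↔ t = x a) ∨
      (∀ t : Typed M k, NFModel.mem (M := M) t w ↔ (t = x a ∨ t = y a)))))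

/-- The pair `⟨a, b⟩` is a member of `g`. -/
def App (M : Type u) [NFModel M] (g a b : M) : Prop := ∃ p : M, NFModel.mem p g ∧ IsPair p a b

instance Stratified.app {k : ℕ} (g : α → Typed M (k + 3)) (x y : α → Typed M k) [IsTerm g]
    [IsTerm x] [IsTerm y] : Stratified M (fun a => App M (g a) (x a) (y a)) :=
  inferInstanceAs (Stratified M (fun a => ∃ p : Typed M (k + 2),
    NFModel.mem (M := M) p (g a) ∧ IsPair (M := M) p (x a) (y a)))

variable (M) in
-- The pair lies at type `k + 2` and the relation at `k + 3`, the offset seen in later uses of `up`.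
-- The pair comes first in the context because it is the variable abstracted.
theorem exists_relation {k : ℕ} (R : Typed M k → Typed M k → Prop)
    [Stratified M (fun a : ((PUnit.{u + 1} × Typed M (k + 2)) × Typed M k) × Typed M k =>
      R a.1.2 a.2)] :
    ∃ g : M, ∀ a b : M, App M g a b ↔ R a b := by
  obtain ⟨g, hg⟩ := exists_set M (fun p : Typed M (k + 2) =>
    ∃ a b : Typed M k, IsPair (M := M) p a b ∧ R a b)
  refine ⟨g, fun a b => ⟨?_, fun h => ?_⟩⟩
  · rintro ⟨p, hp, hab⟩
    obtain ⟨a', b', h, hR⟩ := (hg p).1 hp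
    obtain ⟨rfl, rfl⟩ := hab.inj h
    exact hR
  · obtain ⟨p, hp⟩ := exists_pair a b
    exact ⟨p, (hg p).2 ⟨a, b, hp, h⟩, hp⟩

end

section

/-! ### Basic set constructions and the comparison of sets by injections -/

variable (M : Type u) [NFModel M] {α : Type u} [Context M α]

local notation:50 x:51 " ε " y:51 => NFModel.mem (M := M) x y

/-- `x` is a subset of `y`. -/
def Sub (x y : M) : Prop := ∀ t : M, t ε x → t ε y

/-- `x` is the singleton of `a`. -/
def IsSing (x a : M) : Prop := ∀ t : M, t ε x ↔ t = a

/-- `x` is `y ∪ {a}`. -/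
def IsAdj (x y a : M) : Prop := ∀ t : M, t ε x ↔ (t ε y ∨ t = a)

/-- `x` is the set `USC y` of the singletons of the members of `y`. -/
def IsUsc (x y : M) : Prop := ∀ s : M, s ε x ↔ ∃ a : M, a ε y ∧ IsSing M s a

/-- `x` is the power set of `y`. -/
def IsPow (x y : M) : Prop := ∀ s : M, s ε x ↔ Sub M s y

/-- The set `g` of ordered pairs is a one-to-one correspondence. -/
def IsInjective (g : M) : Prop :=
  ∀ a a' b b' : M, App M g a b → App M g a' b' → (a = a' ↔ b = b')

/-- There is an injection from the members of `y` to the members of `z` which is a set. -/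
def Le (y z : M) : Prop :=
  ∃ g : M, IsInjective M g ∧ ∀ a : M, a ε y → ∃ b : M, b ε z ∧ App M g a b

/-- `y` and `z` embed into each other. -/
def Equiv (y z : M) : Prop := Le M y z ∧ Le M z y

variable {M}

namespace Stratified

variable {k : ℕ}

instance sub (x y : α → Typed M (k + 1)) [IsTerm x] [IsTerm y] :
    Stratified M (fun w => Sub M (x w) (y w)) :=
  inferInstanceAs (Stratified M (fun w => ∀ t : Typed M k, t ε x w → t ε y w))

instance isSing (x : α → Typed M (k + 1)) (a : α → Typed M k) [IsTerm x] [IsTerm a] :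
    Stratified M (fun w => IsSing M (x w) (a w)) :=
  inferInstanceAs (Stratified M (fun w => ∀ t : Typed M k, t ε x w ↔ t = a w))

instance isAdj (x y : α → Typed M (k + 1)) (a : α → Typed M k) [IsTerm x] [IsTerm y] [IsTerm a] :
    Stratified M (fun w => IsAdj M (x w) (y w) (a w)) :=
  inferInstanceAs (Stratified M (fun w => ∀ t : Typed M k, t ε x w ↔ (t ε y w ∨ t = a w)))

instance isUsc (x : α → Typed M (k + 2)) (y : α → Typed M (k + 1)) [IsTerm x] [IsTerm y] :
    Stratified M (fun w => IsUsc M (x w) (y w)) :=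
  inferInstanceAs (Stratified M (fun w => ∀ s : Typed M (k + 1),
    s ε x w ↔ ∃ a : Typed M k, a ε y w ∧ IsSing M s a))

instance isPow (x : α → Typed M (k + 2)) (y : α → Typed M (k + 1)) [IsTerm x] [IsTerm y] :
    Stratified M (fun w => IsPow M (x w) (y w)) :=
  inferInstanceAs (Stratified M (fun w => ∀ s : Typed M (k + 1), s ε x w ↔ Sub M s (y w)))

instance isInjective (g : α → Typed M (k + 3)) [IsTerm g] :
    Stratified M (fun w => IsInjective M (g w)) :=
  inferInstanceAs (Stratified M (fun w => ∀ a a' b b' : Typed M k,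
    App M (g w) a b → App M (g w) a' b' → (a = a' ↔ b = b')))

instance le (y z : α → Typed M (k + 1)) [IsTerm y] [IsTerm z] :
    Stratified M (fun w => Le M (y w) (z w)) :=
  inferInstanceAs (Stratified M (fun w => ∃ g : Typed M (k + 3), IsInjective M g ∧
    ∀ a : Typed M k, a ε y w → ∃ b : Typed M k, b ε z w ∧ App M g a b))

instance equiv (y z : α → Typed M (k + 1)) [IsTerm y] [IsTerm z] :
    Stratified M (fun w => Equiv M (y w) (z w)) :=
  inferInstanceAs (Stratified M (fun w => Le M (y w) (z w) ∧ Le M (z w) (y w)))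

end Stratified

theorem set_ext {x y : M} (h : ∀ t : M, t ε x ↔ t ε y) : x = y := NFModel.extensionality x y h

variable (M) in
theorem exists_univ : ∃ x : M, ∀ t : M, t ε x :=
  (exists_set M (fun t : Typed M 0 => t = t)).imp fun _ h t => (h t).2 rfl

variable (M) in
theorem exists_empty : ∃ x : M, ∀ t : M, ¬ t ε x :=
  (exists_set M (fun t : Typed M 0 => ¬ t = t)).imp fun _ h t ht => (h t).1 ht rfl

theorem exists_sing (a : M) : ∃ x : M, IsSing M x a :=
  exists_set M (fun t : Typed M 0 => t = up 0 a)

theorem exists_adj (y a : M) : ∃ x : M, IsAdj M x y a :=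
  exists_set M (fun t : Typed M 0 => t ε up 1 y ∨ t = up 0 a)

theorem exists_usc (y : M) : ∃ x : M, IsUsc M x y :=
  exists_set M (fun s : Typed M 1 => ∃ a : Typed M 0, a ε up 1 y ∧ IsSing M s a)

theorem exists_pow (y : M) : ∃ x : M, IsPow M x y :=
  exists_set M (fun s : Typed M 1 => Sub M s (up 1 y))

variable (M) in
/-- The universal set. -/
noncomputable def univ : M := (exists_univ M).choose

variable (M) in
/-- The empty set. -/
noncomputable def empty : M := (exists_empty M).choose

/-- The singleton of `a`. -/
noncomputable def sing (a : M) : M := (exists_sing a).choose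

/-- The set `y ∪ {a}`. -/
noncomputable def adj (y a : M) : M := (exists_adj y a).choose

/-- The set of the singletons of the members of `y`. -/
noncomputable def usc (y : M) : M := (exists_usc y).choose

/-- The power set of `y`. -/
noncomputable def pow (y : M) : M := (exists_pow y).choose

theorem mem_univ (t : M) : t ε univ M := (exists_univ M).choose_spec t

theorem notMem_empty (t : M) : ¬ t ε empty M := (exists_empty M).choose_spec t

theorem mem_sing {a t : M} : t ε sing a ↔ t = a := (exists_sing a).choose_spec t

theorem mem_adj {y a t : M} : t ε adj y a ↔ t ε y ∨ t = a := (exists_adj y a).choose_spec t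

theorem isSing_iff {x a : M} : IsSing M x a ↔ x = sing a :=
  ⟨fun h => set_ext fun t => (h t).trans mem_sing.symm, fun h _ => h ▸ mem_sing⟩

theorem isAdj_iff {x y a : M} : IsAdj M x y a ↔ x = adj y a :=
  ⟨fun h => set_ext fun t => (h t).trans mem_adj.symm, fun h _ => h ▸ mem_adj⟩

theorem isUsc_iff {x y : M} : IsUsc M x y ↔ x = usc y :=
  ⟨fun h => set_ext fun t => (h t).trans ((exists_usc y).choose_spec t).symm,
    fun h t => h ▸ (exists_usc y).choose_spec t⟩

theorem isPow_iff {x y : M} : IsPow M x y ↔ x = pow y :=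
  ⟨fun h => set_ext fun t => (h t).trans ((exists_pow y).choose_spec t).symm,
    fun h t => h ▸ (exists_pow y).choose_spec t⟩

theorem mem_usc {y s : M} : s ε usc y ↔ ∃ a, a ε y ∧ s = sing a :=
  ((exists_usc y).choose_spec s).trans (by simp only [isSing_iff])

theorem mem_pow {y s : M} : s ε pow y ↔ Sub M s y := (exists_pow y).choose_spec s

theorem sing_inj {a b : M} : sing a = sing b ↔ a = b :=
  ⟨fun h => mem_sing.1 (h ▸ mem_sing.2 rfl), fun h => h ▸ rfl⟩

theorem sing_mem_usc {y a : M} : sing a ε usc y ↔ a ε y := by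
  simp [mem_usc, sing_inj]

theorem Sub.antisymm {x y : M} (h : Sub M x y) (h' : Sub M y x) : x = y :=
  set_ext fun t => ⟨h t, h' t⟩

theorem adj_eq_self {y a : M} (h : a ε y) : adj y a = y :=
  set_ext fun _ => mem_adj.trans ⟨fun h' => h'.elim id fun e => e ▸ h, .inl⟩

theorem pow_univ : pow (univ M) = univ M :=
  set_ext fun _ => ⟨fun _ => mem_univ _, fun _ => mem_pow.2 fun s _ => mem_univ s⟩

theorem Le.of_relation {y z : M} {k : ℕ} (R : Typed M k → Typed M k → Prop)
    [Stratified M (fun a : ((PUnit.{u + 1} × Typed M (k + 2)) × Typed M k) × Typed M k =>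
      R a.1.2 a.2)] (h : ∀ a a' b b' : M, R a b → R a' b' → (a = a' ↔ b = b'))
    (h' : ∀ a : M, a ε y → ∃ b : M, b ε z ∧ R a b) : Le M y z := by
  obtain ⟨g, hg⟩ := exists_relation M R
  exact ⟨g, fun a a' b b' h1 h2 => h a a' b b' ((hg _ _).1 h1) ((hg _ _).1 h2), fun a ha =>
    (h' a ha).imp fun b hb => ⟨hb.1, (hg _ _).2 hb.2⟩⟩

theorem Le.of_sub {y z : M} (h : Sub M y z) : Le M y z :=
  .of_relation (k := 0) (fun a b => a = b) (by rintro a a' b b' rfl rfl; rfl)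
    fun a ha => ⟨a, h a ha, rfl⟩

theorem Le.refl (y : M) : Le M y y := .of_sub fun _ h => h

theorem Le.trans {x y z : M} (h : Le M x y) (h' : Le M y z) : Le M x z := by
  obtain ⟨f, hf, hf'⟩ := h
  obtain ⟨g, hg, hg'⟩ := h'
  refine .of_relation (k := 0) (fun a c => ∃ b : Typed M 0, App M (up 3 f) a b ∧ App M (up 3 g) b c)
    ?_ fun a ha => ?_
  · rintro a a' c c' ⟨b, h1, h2⟩ ⟨b', h1', h2'⟩
    exact (hf _ _ _ _ h1 h1').trans (hg _ _ _ _ h2 h2')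
  · obtain ⟨b, hb, hab⟩ := hf' a ha
    obtain ⟨c, hc, hbc⟩ := hg' b hb
    exact ⟨c, hc, b, hab, hbc⟩

theorem Equiv.refl (y : M) : Equiv M y y := ⟨.refl y, .refl y⟩

theorem Equiv.symm {y z : M} (h : Equiv M y z) : Equiv M z y := ⟨h.2, h.1⟩

theorem Equiv.trans {x y z : M} (h : Equiv M x y) (h' : Equiv M y z) : Equiv M x z :=
  ⟨h.1.trans h'.1, h'.2.trans h.2⟩

theorem Le.of_inverse {y z g : M} (hg : IsInjective M g)
    (h : ∀ b : M, b ε y → ∃ a : M, a ε z ∧ App M g a b) : Le M y z :=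
  .of_relation (k := 0) (fun b a => App M (up 3 g) a b)
    (fun _ _ _ _ h1 h2 => (hg _ _ _ _ h1 h2).symm) h

/-- The image of an injection, with the injection onto it. -/
theorem Le.exists_image {y z : M} (h : Le M y z) : ∃ g z' : M, IsInjective M g ∧ Sub M z' z ∧
    (∀ a, a ε y → ∃ b, b ε z' ∧ App M g a b) ∧ ∀ b, b ε z' → ∃ a, a ε y ∧ App M g a b := by
  obtain ⟨g, hg, h⟩ := h
  obtain ⟨z', hz'⟩ := exists_set M (fun b : Typed M 0 => b ε up 1 z ∧
    ∃ a : Typed M 0, a ε up 1 y ∧ App M (up 3 g) a b)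
  refine ⟨g, z', hg, fun b hb => ((hz' b).1 hb).1, fun a ha => ?_, fun b hb => ((hz' b).1 hb).2⟩
  obtain ⟨b, hb, hab⟩ := h a ha
  exact ⟨b, (hz' b).2 ⟨hb, a, ha, hab⟩, hab⟩

theorem Le.exists_equiv {y z : M} (h : Le M y z) : ∃ z' : M, Sub M z' z ∧ Equiv M y z' := by
  obtain ⟨g, z', hg, hs, h1, h2⟩ := h.exists_image
  exact ⟨z', hs, ⟨g, hg, h1⟩, .of_inverse hg h2⟩

theorem usc_le_usc {y z : M} (h : Le M y z) : Le M (usc y) (usc z) := by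
  obtain ⟨g, hg, h⟩ := h
  refine .of_relation (k := 1) (fun s t => ∃ a b : Typed M 0, IsSing M s a ∧ IsSing M t b ∧
    App M (up 3 g) a b) ?_ fun s hs => ?_
  · rintro s s' t t' ⟨a, b, hs, ht, hab⟩ ⟨a', b', hs', ht', hab'⟩
    obtain rfl := isSing_iff.1 hs
    obtain rfl := isSing_iff.1 ht
    obtain rfl := isSing_iff.1 hs'
    obtain rfl := isSing_iff.1 ht'
    have := hg _ _ _ _ hab hab'
    exact sing_inj.trans (this.trans sing_inj.symm)
  · obtain ⟨a, ha, rfl⟩ := mem_usc.1 hs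
    obtain ⟨b, hb, hab⟩ := h a ha
    exact ⟨sing b, sing_mem_usc.2 hb, a, b, isSing_iff.2 rfl, isSing_iff.2 rfl, hab⟩

theorem le_of_usc_le_usc {y z : M} (h : Le M (usc y) (usc z)) : Le M y z := by
  obtain ⟨g, hg, h⟩ := h
  refine .of_relation (k := 0) (fun a b => ∃ s t : Typed M 1, IsSing M s a ∧ IsSing M t b ∧
    App M (up 4 g) s t) ?_ fun a ha => ?_
  · rintro a a' b b' ⟨s, t, hs, ht, hab⟩ ⟨s', t', hs', ht', hab'⟩
    obtain rfl := isSing_iff.1 hs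
    obtain rfl := isSing_iff.1 ht
    obtain rfl := isSing_iff.1 hs'
    obtain rfl := isSing_iff.1 ht'
    have := hg _ _ _ _ hab hab'
    exact sing_inj.symm.trans (this.trans sing_inj)
  · obtain ⟨t, ht, hab⟩ := h _ (sing_mem_usc.2 ha)
    obtain ⟨b, hb, rfl⟩ := mem_usc.1 ht
    exact ⟨b, hb, sing (M := M) a, sing (M := M) b, isSing_iff.2 rfl, isSing_iff.2 rfl, hab⟩

/-- A subset is matched with its direct image. Confining `t` to the exact range `z'` makes each of
`s` and `t` determine the other. -/
theorem pow_le_pow {y z : M} (h : Le M y z) : Le M (pow y) (pow z) := by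
  obtain ⟨g, z', hg, hs, h1, h2⟩ := h.exists_image
  refine .of_relation (k := 1) (fun s t => Sub M s (up 1 y) ∧ Sub M t (up 1 z') ∧
    ∀ a b : Typed M 0, App M (up 3 g) a b → (a ε s ↔ b ε t)) ?_ fun s hs' => ?_
  · rintro s s' t t' ⟨hs, ht, h⟩ ⟨hs', ht', h'⟩
    constructor
    · rintro rfl
      refine set_ext fun b => ⟨fun hb => ?_, fun hb => ?_⟩
      · obtain ⟨a, -, hab⟩ := h2 b (ht b hb)
        exact (h' a b hab).1 ((h a b hab).2 hb)
      · obtain ⟨a, -, hab⟩ := h2 b (ht' b hb)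
        exact (h a b hab).1 ((h' a b hab).2 hb)
    · rintro rfl
      refine set_ext fun a => ⟨fun ha => ?_, fun ha => ?_⟩
      · obtain ⟨b, -, hab⟩ := h1 a (hs a ha)
        exact (h' a b hab).2 ((h a b hab).1 ha)
      · obtain ⟨b, -, hab⟩ := h1 a (hs' a ha)
        exact (h a b hab).2 ((h' a b hab).1 ha)
  · rw [mem_pow] at hs'
    obtain ⟨t, ht⟩ := exists_set M (fun b : Typed M 0 => b ε up 1 z' ∧
      ∃ a : Typed M 0, a ε up 1 s ∧ App M (up 3 g) a b)
    have htz : Sub M t z' := fun b hb => ((ht b).1 hb).1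
    refine ⟨t, mem_pow.2 fun b hb => hs b (htz b hb), hs', htz, fun a b hab => ?_⟩
    refine ⟨fun ha => (ht b).2 ⟨?_, a, ha, hab⟩, fun hb => ?_⟩
    · obtain ⟨b', hb', hab'⟩ := h1 a (hs' a ha)
      rwa [(hg _ _ _ _ hab hab').1 rfl]
    · obtain ⟨-, a', ha', hab'⟩ := (ht b).1 hb
      rwa [(hg _ _ _ _ hab hab').2 rfl]

/-- `USC (P y)` and `P (USC y)` are equinumerous. -/
theorem usc_pow_equiv (y : M) : Equiv M (usc (pow y))
    (pow (usc y)) := by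
  -- Both {s} and USC s lie one type above s, so the correspondence between them is stratified.
  obtain ⟨g, hg⟩ := exists_relation M (fun u t : Typed M 2 => ∃ s : Typed M 1, IsSing M u s ∧
    IsUsc M t s)
  have hg' : ∀ a b, App M g a b ↔ ∃ s, a = sing s ∧ b = usc s := fun a b =>
    (hg a b).trans (exists_congr fun s => and_congr isSing_iff isUsc_iff)
  have inj : ∀ {s s' : M}, usc s = usc s' → s = s' := fun h =>
    set_ext fun t => by rw [← sing_mem_usc, h, sing_mem_usc]
  have hI : IsInjective M g := by
    intro a a' b b' h h'
    obtain ⟨s, rfl, rfl⟩ := (hg' _ _).1 h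
    obtain ⟨s', rfl, rfl⟩ := (hg' _ _).1 h'
    exact sing_inj.trans ⟨fun h => h ▸ rfl, inj⟩
  refine ⟨⟨g, hI, fun u hu => ?_⟩, .of_inverse hI fun t ht => ?_⟩
  · obtain ⟨s, hs, rfl⟩ := mem_usc.1 hu
    refine ⟨usc s, mem_pow.2 fun v hv => ?_, (hg' _ _).2 ⟨s, rfl, rfl⟩⟩
    obtain ⟨a, ha, rfl⟩ := mem_usc.1 hv
    exact sing_mem_usc.2 (mem_pow.1 hs a ha)
  · rw [mem_pow] at ht
    obtain ⟨s, hs⟩ := exists_set M (fun a : Typed M 0 => ∃ v : Typed M 1, IsSing M v a ∧ v ε up 2 t)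
    have hs' : ∀ a, a ε s ↔ sing a ε t := fun a => by
      rw [hs a]
      exact ⟨fun ⟨v, hv, h⟩ => isSing_iff.1 hv ▸ h, fun h => ⟨_, isSing_iff.2 rfl, h⟩⟩
    refine ⟨sing s, sing_mem_usc.2 (mem_pow.2 fun a ha => sing_mem_usc.1 (ht _ ((hs' a).1 ha))),
      (hg' _ _).2 ⟨s, rfl, set_ext fun v => ⟨fun hv => ?_, fun hv => ?_⟩⟩⟩
    · obtain ⟨a, ha, rfl⟩ := mem_usc.1 (ht v hv)
      exact sing_mem_usc.2 ((hs' a).2 hv)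
    · obtain ⟨a, ha, rfl⟩ := mem_usc.1 hv
      exact (hs' a).1 ha

/-- Every set which is not larger than `USC V` is equinumerous with `USC w` for some `w`. -/
theorem exists_equiv_usc {y v : M} (h : Le M y (usc v)) :
    ∃ w, Equiv M y (usc w) := by
  obtain ⟨z, hz, hyz⟩ := h.exists_equiv
  -- A subset of `usc v` consists of singletons, so it is `usc` of its union.
  obtain ⟨w, hw⟩ := exists_set M (fun a : Typed M 0 => ∃ s : Typed M 1, IsSing M s a ∧ s ε up 2 z)
  refine ⟨w, (?_ : z = usc w) ▸ hyz⟩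
  have hw' : ∀ a, a ε w ↔ sing a ε z := fun a => by
    rw [hw a]
    exact ⟨fun ⟨v, hv, h⟩ => isSing_iff.1 hv ▸ h, fun h => ⟨_, isSing_iff.2 rfl, h⟩⟩
  refine set_ext fun s => ⟨fun hs => ?_, fun hs => ?_⟩
  · obtain ⟨a, -, rfl⟩ := mem_usc.1 (hz s hs)
    exact sing_mem_usc.2 ((hw' a).2 hs)
  · obtain ⟨a, ha, rfl⟩ := mem_usc.1 hs
    exact (hw' a).1 ha

end

section

/-! ### The universe is Dedekind infinite -/

set_option synthInstance.maxHeartbeats 200000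
set_option synthInstance.maxSize 2000

variable (M : Type u) [NFModel M] {α : Type u} [Context M α]

local notation:50 x:51 " ε " y:51 => NFModel.mem (M := M) x y

/-- No injection of the universe into itself misses an element. -/
def DedekindFinite : Prop :=
  ∀ g : M, IsInjective M g → (∀ a, ∃ b, App M g a b) → ∀ b, ∃ a, App M g a b

/-- The universe belongs to every inductive family of sets. -/
def InductivelyFinite : Prop :=
  ∀ C : M, empty M ε C → (∀ y a : M, y ε C → adj y a ε C) → univ M ε C

/-- `n` is the class of all sets equinumerous with `y`. -/
def IsCard (n y : M) : Prop := ∀ z : M, z ε n ↔ Equiv M z y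

variable {M}

instance Stratified.isCard {k : ℕ} (n : α → Typed M (k + 2)) (y : α → Typed M (k + 1)) [IsTerm n]
    [IsTerm y] : Stratified M (fun w => IsCard M (n w) (y w)) :=
  inferInstanceAs (Stratified M (fun w => ∀ z : Typed M (k + 1), z ε n w ↔ Equiv M z (y w)))

theorem exists_isCard (y : M) : ∃ n, IsCard M n y :=
  exists_set M (fun z : Typed M 1 => Equiv M z (up 1 y))

theorem IsCard.eq_iff {n n' y y' : M} (h : IsCard M n y) (h' : IsCard M n' y') :
    n = n' ↔ Equiv M y y' := by
  constructor
  · rintro rfl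
    exact (h' y).1 ((h y).2 (.refl y))
  · exact fun e => set_ext fun z => (h z).trans
      (Iff.trans ⟨fun hz => hz.trans e, fun hz => hz.trans e.symm⟩ (h' z).symm)

theorem Le.adj_adj {y z a b : M} (h : Le M y z) (ha : ¬ a ε y) (hb : ¬ b ε z) :
    Le M (adj y a) (adj z b) := by
  obtain ⟨g, hg, h⟩ := h
  refine .of_relation (k := 0) (fun u v => (u ε up 1 y ∧ v ε up 1 z ∧ App M (up 3 g) u v) ∨
    (u = up 0 a ∧ v = up 0 b)) ?_ fun u hu => ?_
  · rintro u u' v v' (⟨hu, hv, huv⟩ | ⟨rfl, rfl⟩) (⟨hu', hv', huv'⟩ | ⟨rfl, rfl⟩)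
    · exact hg _ _ _ _ huv huv'
    · exact ⟨fun e => (ha (e ▸ hu)).elim, fun e => (hb (e ▸ hv)).elim⟩
    · exact ⟨fun e => (ha (e ▸ hu')).elim, fun e => (hb (e ▸ hv')).elim⟩
    · exact ⟨fun _ => rfl, fun _ => rfl⟩
  · obtain hu | rfl := mem_adj.1 hu
    · obtain ⟨v, hv, huv⟩ := h u hu
      exact ⟨v, mem_adj.2 (.inl hv), .inl ⟨hu, hv, huv⟩⟩
    · exact ⟨b, mem_adj.2 (.inr rfl), .inr ⟨rfl, rfl⟩⟩

/-- An element of `y` that is sent to `b` is rerouted to the image of `a`. -/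
theorem Le.of_adj_adj {y z a b : M} (h : Le M (adj y a) (adj z b)) (ha : ¬ a ε y) :
    Le M y z := by
  obtain ⟨g, hg, h⟩ := h
  refine .of_relation (k := 0) (fun u v => (u ε up 1 y ∧ ¬ v = up 0 b ∧ App M (up 3 g) u v) ∨
    (u ε up 1 y ∧ App M (up 3 g) u (up 0 b) ∧ App M (up 3 g) (up 0 a) v)) ?_ fun u hu => ?_
  · rintro u u' v v' (⟨hu, hv, huv⟩ | ⟨hu, hub, hav⟩) (⟨hu', hv', huv'⟩ | ⟨hu', hub', hav'⟩)
    · exact hg _ _ _ _ huv huv'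
    · refine ⟨fun e => (hv ((hg _ _ _ _ huv hub').1 e)).elim, fun e => ?_⟩
      exact (ha (Eq.subst (motive := fun t : M => t ε y) ((hg _ _ _ _ huv hav').2 e) hu)).elim
    · refine ⟨fun e => (hv' ((hg _ _ _ _ huv' hub).1 e.symm)).elim, fun e => ?_⟩
      exact (ha (Eq.subst (motive := fun t : M => t ε y) ((hg _ _ _ _ huv' hav).2 e.symm) hu')).elim
    · exact ⟨fun _ => (hg _ _ _ _ hav hav').1 rfl, fun _ => (hg _ _ _ _ hub hub').2 rfl⟩
  · obtain ⟨v, hv, huv⟩ := h u (mem_adj.2 (.inl hu))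
    by_cases hvb : v = b
    · subst hvb
      obtain ⟨w, hw, haw⟩ := h a (mem_adj.2 (.inr rfl))
      refine ⟨w, (mem_adj.1 hw).resolve_right fun e => ?_, .inr ⟨hu, huv, haw⟩⟩
      exact ha ((hg _ _ _ _ huv haw).2 e.symm ▸ hu)
    · exact ⟨v, (mem_adj.1 hv).resolve_right hvb, .inl ⟨hu, hvb, huv⟩⟩

/-- If an inductive family `C` omits the universe, map |y| to |y ∪ {a}| (with a ∉ y) on the
cardinals of members of `C`, and fix everything else. This is total because no member of `C` is the
universe, injective by cancellation of the added point, and it misses |∅|. -/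
theorem DedekindFinite.inductivelyFinite (hD : DedekindFinite M) : InductivelyFinite M := by
  intro C hC hC'
  by_contra hV
  obtain ⟨g, hg⟩ := exists_relation M (fun n m : Typed M 2 =>
    (∃ y y' : Typed M 1, ∃ a : Typed M 0, y ε up 2 C ∧ ¬ a ε y ∧ IsAdj M y' y a ∧
      IsCard M n y ∧ IsCard M m y') ∨ ((¬ ∃ y : Typed M 1, y ε up 2 C ∧ IsCard M n y) ∧ n = m))
  replace hg : ∀ n m : M, App M g n m ↔
      (∃ y a : M, y ε C ∧ ¬ a ε y ∧ IsCard M n y ∧ IsCard M m (adj y a)) ∨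
        ((¬ ∃ y : M, y ε C ∧ IsCard M n y) ∧ n = m) := by
    refine fun n m => (hg n m).trans (or_congr_left ⟨?_, ?_⟩)
    · rintro ⟨y, y', a, hy, ha, hy', h⟩
      obtain rfl := isAdj_iff.1 hy'
      exact ⟨y, a, hy, ha, h⟩
    · rintro ⟨y, a, hy, ha, h⟩
      exact ⟨y, adj (M := M) y a, a, hy, ha, isAdj_iff.2 rfl, h⟩
  obtain ⟨z, hz⟩ := exists_isCard (empty M)
  suffices h : IsInjective M g ∧ ∀ a, ∃ b, App M g a b by
    obtain ⟨n, hn⟩ := hD g h.1 h.2 z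
    obtain ⟨y, a, -, -, -, h⟩ | ⟨h, rfl⟩ := (hg _ _).1 hn
    · obtain ⟨f, -, hf⟩ := ((h.eq_iff hz).1 rfl).1
      obtain ⟨b, hb, -⟩ := hf a (mem_adj.2 (.inr rfl))
      exact notMem_empty b hb
    · exact h ⟨_, hC, hz⟩
  refine ⟨?_, ?_⟩
  · intro n n' m m' h h'
    obtain ⟨y, a, hy, ha, hn, hm⟩ | ⟨hn, rfl⟩ := (hg _ _).1 h <;>
    obtain ⟨y', a', hy', ha', hn', hm'⟩ | ⟨hn', rfl⟩ := (hg _ _).1 h'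
    · rw [hn.eq_iff hn', hm.eq_iff hm']
      exact ⟨fun e => ⟨e.1.adj_adj ha ha', e.2.adj_adj ha' ha⟩,
        fun e => ⟨e.1.of_adj_adj ha, e.2.of_adj_adj ha'⟩⟩
    · exact ⟨fun e => (hn' ⟨y, hy, e ▸ hn⟩).elim, fun e => (hn' ⟨_, hC' _ _ hy, e ▸ hm⟩).elim⟩
    · exact ⟨fun e => (hn ⟨y', hy', e ▸ hn'⟩).elim, fun e => (hn ⟨_, hC' _ _ hy', e ▸ hm'⟩).elim⟩
    · rfl
  · intro n
    by_cases hn : ∃ y : M, y ε C ∧ IsCard M n y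
    · obtain ⟨y, hy, hn⟩ := hn
      obtain ⟨a, ha⟩ : ∃ a, ¬ a ε y := by
        by_contra! h
        exact hV ((set_ext fun t => ⟨fun _ => h t, fun _ => mem_univ t⟩ : univ M = y) ▸ hy)
      obtain ⟨m, hm⟩ := exists_isCard (adj y a)
      exact ⟨m, (hg _ _).2 (.inl ⟨y, a, hy, ha, hn, hm⟩)⟩
    · exact ⟨n, (hg _ _).2 (.inr ⟨hn, rfl⟩)⟩

/-- An injection of `z` into `y`, extended by the identity outside `z`, would miss any point of `z`
not in `y`. -/
theorem DedekindFinite.eq_of_sub_of_le (hD : DedekindFinite M) {y z : M} (h : Sub M y z)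
    (h' : Le M z y) : y = z := by
  refine h.antisymm fun c hc => ?_
  by_contra hcy
  obtain ⟨f, hf, hf'⟩ := h'
  obtain ⟨g, hg⟩ := exists_relation M (fun a b : Typed M 0 =>
    (a ε up 1 z ∧ b ε up 1 y ∧ App M (up 3 f) a b) ∨ (¬ a ε up 1 z ∧ a = b))
  suffices h : IsInjective M g ∧ ∀ a, ∃ b, App M g a b by
    obtain ⟨a, ha⟩ := hD g h.1 h.2 c
    obtain ⟨-, hc', -⟩ | ⟨hc', rfl⟩ := (hg _ _).1 ha
    · exact hcy hc'
    · exact hc' hc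
  refine ⟨?_, ?_⟩
  · intro a a' b b' h1 h2
    obtain ⟨ha, hb, hab⟩ | ⟨ha, rfl⟩ := (hg _ _).1 h1 <;>
    obtain ⟨ha', hb', hab'⟩ | ⟨ha', rfl⟩ := (hg _ _).1 h2
    · exact hf _ _ _ _ hab hab'
    · exact ⟨fun e => (ha' (e ▸ ha)).elim, fun e => (ha' (e ▸ h _ hb)).elim⟩
    · exact ⟨fun e => (ha (e ▸ ha')).elim, fun e => (ha (e ▸ h _ hb')).elim⟩
    · rfl
  · intro a
    by_cases ha : a ε z
    · obtain ⟨b, hb, hab⟩ := hf' a ha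
      exact ⟨b, (hg _ _).2 (.inl ⟨ha, hb, hab⟩)⟩
    · exact ⟨a, (hg _ _).2 (.inr ⟨ha, rfl⟩)⟩

/-- An embedding that cannot be inverted misses a point of `z`, which is free to receive `a`. -/
theorem Le.adj_of_not_le {y z : M} (h : Le M y z) (h' : ¬ Le M z y) (a : M) :
    Le M (adj y a) z := by
  by_cases ha : a ε y
  · rwa [adj_eq_self ha]
  obtain ⟨g, hg, h⟩ := h
  obtain ⟨c, hc, hc'⟩ : ∃ c, c ε z ∧ ∀ u, u ε y → ¬ App M g u c := by
    by_contra! hcon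
    exact h' (.of_inverse hg hcon)
  refine .of_relation (k := 0) (fun u v => (u ε up 1 y ∧ App M (up 3 g) u v) ∨
    (u = up 0 a ∧ v = up 0 c)) ?_ fun u hu => ?_
  · rintro u u' v v' (⟨hu, huv⟩ | ⟨rfl, rfl⟩) (⟨hu', huv'⟩ | ⟨rfl, rfl⟩)
    · exact hg _ _ _ _ huv huv'
    · exact ⟨fun e => (ha (e ▸ hu)).elim, fun e => (hc' u hu (e ▸ huv)).elim⟩
    · exact ⟨fun e => (ha (e ▸ hu')).elim, fun e => (hc' u' hu' (e ▸ huv')).elim⟩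
    · exact ⟨fun _ => rfl, fun _ => rfl⟩
  · obtain hu | rfl := mem_adj.1 hu
    · obtain ⟨v, hv, huv⟩ := h u hu
      exact ⟨v, hv, .inl ⟨hu, huv⟩⟩
    · exact ⟨c, hc, .inr ⟨rfl, rfl⟩⟩

/-! ### Comparison of sets in a finite universe -/

namespace InductivelyFinite

variable (hF : InductivelyFinite M)

include hF

/-- Induction proves comparability with `z` for all subsets of a set at once, because the only
conclusion it yields concerns the universe. -/
theorem le_total (y z : M) : Le M y z ∨ Le M z y := by
  obtain ⟨C, hC⟩ := exists_set M (fun y : Typed M 1 => ∀ w : Typed M 1, Sub M w y →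
    (Le M w (up 1 z) ∨ Le M (up 1 z) w))
  refine (hC _).1 (hF C ((hC _).2 fun w hw => .inl ?_) fun y a hy => (hC _).2 fun (w : M) hw => ?_) y
    fun t _ => mem_univ t
  · exact .of_sub fun t ht => (notMem_empty t (hw t ht)).elim
  · obtain ⟨w', hw'⟩ := exists_set M (fun t : Typed M 0 => t ε up 1 w ∧ t ε up 1 y)
    have hs : Sub M w' w := fun t ht => ((hw' t).1 ht).1
    have hs' : Sub M w (adj w' a) := fun t ht => mem_adj.2
      ((mem_adj.1 (hw t ht)).imp (fun h => (hw' t).2 ⟨ht, h⟩) id)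
    by_cases hz : Le M z w'
    · exact .inr (hz.trans (.of_sub hs))
    · have := ((hC _).1 hy w' fun t ht => ((hw' t).1 ht).2).resolve_right hz
      exact .inl (.trans (.of_sub hs') (this.adj_of_not_le hz a))

/-- Without a least member, the sets that embed in every member of `B` form an inductive family. The
universe would then embed in every member, making all of them least. -/
theorem exists_minimal {B b : M} (hb : b ε B) : ∃ x, x ε B ∧ ∀ y, y ε B → Le M x y := by
  by_contra! hcon
  obtain ⟨C, hC⟩ := exists_set M (fun y : Typed M 1 => ∀ x : Typed M 1, x ε up 2 B → Le M y x)
  have hV := (hC _).1 (hF C ((hC _).2 fun x _ => ?_) fun y a hy => (hC _).2 fun x hx => ?_)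
  · obtain ⟨y, hy, h⟩ := hcon b hb
    exact h (.trans (.of_sub fun t _ => mem_univ t) (hV y hy))
  · exact .of_sub fun t ht => (notMem_empty t ht).elim
  · obtain ⟨x', hx', h⟩ := hcon x hx
    exact ((hC _).1 hy x hx).adj_of_not_le (fun h' => h (h'.trans ((hC _).1 hy x' hx'))) a

/-- Otherwise `y` has a copy z' ⊆ z. Finiteness forces P z' = P z, whence z ⊆ z'. -/
theorem le_of_pow_le_pow (hD : DedekindFinite M) {y z : M} (h : Le M (pow z) (pow y)) :
    Le M z y := by
  obtain h' | h' := hF.le_total z y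
  · exact h'
  · obtain ⟨z', hz', e⟩ := h'.exists_equiv
    have hs : Sub M (pow z') (pow z) := fun s hs =>
      mem_pow.2 fun t ht => hz' t (mem_pow.1 hs t ht)
    have hp := hD.eq_of_sub_of_le hs (h.trans (pow_le_pow e.1))
    have : Sub M z z' := mem_pow.1 (hp ▸ mem_pow.2 fun _ h => h)
    exact .trans (.of_sub this) e.2

end InductivelyFinite

/-- Among finite sets Cantor's theorem needs no diagonal: the singletons form a proper part of the
power set, which also contains ∅. -/
theorem DedekindFinite.not_pow_le_usc (hD : DedekindFinite M) (y : M) :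
    ¬ Le M (pow y) (usc y) := by
  intro h
  have hs : Sub M (usc y) (pow y) := fun s hs => by
    obtain ⟨a, ha, rfl⟩ := mem_usc.1 hs
    exact mem_pow.2 fun t ht => mem_sing.1 ht ▸ ha
  have : empty M ε usc y :=
    hD.eq_of_sub_of_le hs h ▸ mem_pow.2 fun t ht => (notMem_empty t ht).elim
  obtain ⟨a, -, ha⟩ := mem_usc.1 this
  exact notMem_empty a (ha ▸ mem_sing.2 rfl)

/-! ### Specker's parity argument -/

variable (M) in
/-- `C` is closed under equinumerosity, contains the sets that are not equinumerous with a power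
set, and is closed under the double application of the exponential map `|USC y| ↦ |P y|`. -/
structure EvenClosed (C : M) : Prop where
  equiv : ∀ x z : M, x ε C → Equiv M x z → z ε C
  base : ∀ x : M, (∀ y, ¬ Equiv M x (pow y)) → x ε C
  step : ∀ y z : M, usc y ε C → Equiv M (pow y) (usc z) → pow z ε C

/-- Trades the operations `usc` and `pow` for bound variables and relations, the form for which
stratification instances exist. -/
theorem evenClosed_iff (C : M) : EvenClosed M C ↔ (∀ x z : M, x ε C → Equiv M x z → z ε C) ∧
    (∀ x : M, (∀ y p : M, IsPow M p y → ¬ Equiv M x p) → x ε C) ∧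
    ∀ y z u p v q : M, IsUsc M u y → IsPow M p y → IsUsc M v z → IsPow M q z → u ε C →
      Equiv M p v → q ε C := by
  simp only [isPow_iff, isUsc_iff, forall_eq]
  constructor
  · rintro ⟨h1, h2, h3⟩
    refine ⟨h1, h2, ?_⟩
    rintro y z _ _ _ _ rfl rfl rfl rfl
    exact h3 y z
  · rintro ⟨h1, h2, h3⟩
    exact ⟨h1, h2, fun y z => h3 y z _ _ _ _ rfl rfl rfl rfl⟩

instance Stratified.evenClosed {k : ℕ} (C : α → Typed M (k + 3)) [IsTerm C] :
    Stratified M (fun w => EvenClosed M (C w)) :=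
  .congr (P := fun w =>
    (∀ x z : Typed M (k + 2), x ε C w → Equiv M x z → z ε C w) ∧
    (∀ x : Typed M (k + 2), (∀ y : Typed M (k + 1), ∀ p : Typed M (k + 2), IsPow M p y →
      ¬ Equiv M x p) → x ε C w) ∧
    ∀ y z : Typed M (k + 1), ∀ u p v q : Typed M (k + 2), IsUsc M u y → IsPow M p y →
      IsUsc M v z → IsPow M q z → u ε C w → Equiv M p v → q ε C w) inferInstance
    fun _ => (evenClosed_iff (M := M) _).symm

variable (M) in
-- The intersection of all closed sets is a set because `EvenClosed` is stratified; this replaces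
-- counting steps of the exponential map.
theorem exists_evens : ∃ C : M, EvenClosed M C ∧ ∀ D : M, EvenClosed M D → Sub M C D := by
  obtain ⟨C, hC⟩ := exists_set M (fun x : Typed M 2 => ∀ D : Typed M 3, EvenClosed M D → x ε D)
  refine ⟨C, ⟨fun x z hx e => ?_, fun x hx => ?_, fun y z hy e => ?_⟩,
    fun D hD x hx => (hC x).1 hx D hD⟩
  · exact (hC z).2 fun D hD => hD.equiv x z ((hC x).1 hx D hD) e
  · exact (hC x).2 fun D hD => hD.base x hx
  · exact (hC _).2 fun D hD => hD.step y z ((hC _).1 hy D hD) e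

/-- The members of `C` that arise from the base or the step clause already form a closed set, so
minimality makes them all of `C`. -/
theorem evens_cases {C : M} (hC : EvenClosed M C) (hmin : ∀ D : M, EvenClosed M D → Sub M C D)
    {x : M} (hx : x ε C) : (∀ y, ¬ Equiv M x (pow y)) ∨
      ∃ y z, usc y ε C ∧ Equiv M (pow y) (usc z) ∧ Equiv M x (pow z) := by
  obtain ⟨D, hD⟩ := exists_set M (fun x : Typed M 2 => x ε up 3 C ∧
    ((∀ y : Typed M 1, ∀ p : Typed M 2, IsPow M p y → ¬ Equiv M x p) ∨
      ∃ y z : Typed M 1, ∃ u p v q : Typed M 2, IsUsc M u y ∧ IsPow M p y ∧ IsUsc M v z ∧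
        IsPow M q z ∧ u ε up 3 C ∧ Equiv M p v ∧ Equiv M x q))
  replace hD : ∀ x : M, x ε D ↔ x ε C ∧ ((∀ y, ¬ Equiv M x (pow y)) ∨
      ∃ y z, usc y ε C ∧ Equiv M (pow y) (usc z) ∧ Equiv M x (pow z)) := by
    refine fun x => (hD x).trans (and_congr_right fun _ => or_congr ?_ ?_)
    · exact ⟨fun h y => h y _ (isPow_iff.2 rfl), fun h y p hp => isPow_iff.1 hp ▸ h y⟩
    · constructor
      · rintro ⟨y, z, u, p, v, q, hu, hp, hv, hq, h⟩
        obtain rfl := isUsc_iff.1 hu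
        obtain rfl := isUsc_iff.1 hv
        obtain rfl := isPow_iff.1 hp
        obtain rfl := isPow_iff.1 hq
        exact ⟨y, z, h⟩
      · rintro ⟨y, z, h⟩
        exact ⟨y, z, usc (M := M) y, pow (M := M) y, usc (M := M) z, pow (M := M) z,
          isUsc_iff.2 rfl, isPow_iff.2 rfl, isUsc_iff.2 rfl, isPow_iff.2 rfl, h⟩
  refine ((hD x).1 (hmin D ⟨fun x z hx e => ?_, fun x hx => ?_, fun y z hy e => ?_⟩ x hx)).2
  · obtain ⟨h, h'⟩ := (hD x).1 hx
    refine (hD z).2 ⟨hC.equiv _ _ h e, h'.imp (fun h y hy => h y (e.trans hy)) ?_⟩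
    rintro ⟨y, w, h1, h2, h3⟩
    exact ⟨y, w, h1, h2, e.symm.trans h3⟩
  · exact (hD x).2 ⟨hC.base x hx, .inl hx⟩
  · have := ((hD _).1 hy).1
    exact (hD _).2 ⟨hC.step y z this e, .inr ⟨y, z, this, e, .refl _⟩⟩

theorem Equiv.usc {y z : M} (h : Equiv M y z) : Equiv M (usc y) (usc z) :=
  ⟨usc_le_usc h.1, usc_le_usc h.2⟩

theorem Equiv.of_usc {y z : M} (h : Equiv M (NewFoundations.usc y) (NewFoundations.usc z)) :
    Equiv M y z :=
  ⟨le_of_usc_le_usc h.1, le_of_usc_le_usc h.2⟩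

theorem Equiv.pow {y z : M} (h : Equiv M y z) : Equiv M (pow y) (pow z) :=
  ⟨pow_le_pow h.1, pow_le_pow h.2⟩

variable (M) in
/-- Specker's theorem: the universe of a model of NF is infinite. -/
theorem not_dedekindFinite : ¬ DedekindFinite M := by
  intro hD
  have hF := hD.inductivelyFinite
  obtain ⟨C, hC, hmin⟩ := exists_evens M
  have pow_inj : ∀ {y z : M}, Equiv M (pow y) (pow z) → Equiv M y z := fun h =>
    ⟨hF.le_of_pow_le_pow hD h.1, hF.le_of_pow_le_pow hD h.2⟩
  -- the exponential map exchanges the members of `C` and the other sets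
  have notMem : ∀ y : M, usc y ε C → ¬ pow y ε C := by
    intro y hy hy'
    obtain ⟨B, hB⟩ := exists_set M (fun x : Typed M 2 => ∃ y : Typed M 1, ∃ u p : Typed M 2,
      IsUsc M u y ∧ IsPow M p y ∧ Equiv M x u ∧ u ε up 3 C ∧ p ε up 3 C)
    replace hB : ∀ x : M, x ε B ↔ ∃ y, Equiv M x (usc y) ∧ usc y ε C ∧ pow y ε C := by
      refine fun x => (hB x).trans ⟨?_, ?_⟩
      · rintro ⟨y, u, p, hu, hp, h⟩
        obtain rfl := isUsc_iff.1 hu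
        obtain rfl := isPow_iff.1 hp
        exact ⟨y, h⟩
      · rintro ⟨y, h⟩
        exact ⟨y, usc (M := M) y, pow (M := M) y, isUsc_iff.2 rfl, isPow_iff.2 rfl, h⟩
    obtain ⟨x, hx, hmin'⟩ := hF.exists_minimal ((hB _).2 ⟨y, .refl _, hy, hy'⟩)
    obtain ⟨y, e, hy, hy'⟩ := (hB _).1 hx
    obtain h | ⟨y', z, h, e1, e2⟩ := evens_cases hC hmin hy'
    · exact h y (.refl _)
    -- Here USC y ~ P y', so y' is again a counterexample; minimality of USC y would embed P y' in
    -- USC y'.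
    · have e3 := (pow_inj e2).usc.trans e1.symm
      refine hD.not_pow_le_usc y' ((e.trans e3).2.trans (hmin' _ ((hB _).2 ⟨y', .refl _, h, ?_⟩)))
      exact hC.equiv _ _ hy e3
  have mem : ∀ y : M, ¬ pow y ε C → usc y ε C := by
    intro y hy'
    by_contra hy
    obtain ⟨B, hB⟩ := exists_set M (fun x : Typed M 2 => ∃ y : Typed M 1, ∃ u p : Typed M 2,
      IsUsc M u y ∧ IsPow M p y ∧ Equiv M x u ∧ ¬ u ε up 3 C ∧ ¬ p ε up 3 C)
    replace hB : ∀ x : M, x ε B ↔ ∃ y, Equiv M x (usc y) ∧ ¬ usc y ε C ∧ ¬ pow y ε C := by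
      refine fun x => (hB x).trans ⟨?_, ?_⟩
      · rintro ⟨y, u, p, hu, hp, h⟩
        obtain rfl := isUsc_iff.1 hu
        obtain rfl := isPow_iff.1 hp
        exact ⟨y, h⟩
      · rintro ⟨y, h⟩
        exact ⟨y, usc (M := M) y, pow (M := M) y, isUsc_iff.2 rfl, isPow_iff.2 rfl, h⟩
    obtain ⟨x, hx, hmin'⟩ := hF.exists_minimal ((hB _).2 ⟨y, .refl _, hy, hy'⟩)
    obtain ⟨y, e, hy, hy'⟩ := (hB _).1 hx
    obtain ⟨z, e1⟩ : ∃ z, Equiv M (usc y) (pow z) := by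
      by_contra! h
      exact hy (hC.base _ h)
    have hz : ¬ pow z ε C := fun h => hy (hC.equiv _ _ h e1.symm)
    by_cases h : usc z ε C
    · exact hy' (hC.step z y h e1.symm)
    · exact hD.not_pow_le_usc z ((e.trans e1).2.trans (hmin' _ ((hB _).2 ⟨z, .refl _, h, hz⟩)))
  -- `USC` preserves membership in `C`
  have usc_mem : ∀ x : M, x ε C → usc x ε C := by
    obtain ⟨D, hD'⟩ := exists_set M (fun x : Typed M 2 => ∃ u : Typed M 3, IsUsc M u x ∧
      u ε up 4 C)
    replace hD' : ∀ x : M, x ε D ↔ usc x ε C := fun x => (hD' x).trans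
      ⟨fun ⟨u, hu, h⟩ => isUsc_iff.1 hu ▸ h, fun h => ⟨_, isUsc_iff.2 rfl, h⟩⟩
    refine fun x hx => (hD' x).1 (hmin D ⟨fun x z hx e => ?_, fun x hx => ?_,
      fun y z hy e => ?_⟩ x hx)
    · exact (hD' z).2 (hC.equiv _ _ ((hD' x).1 hx) e.usc)
    · refine (hD' x).2 (hC.base _ fun y e => ?_)
      -- P y embeds in USC V = USC (P V) ~ P (USC V); cancelling P bounds y by USC V, so y ~ USC w
      -- and x ~ P w.
      have hy : Le M y (usc (univ M)) := hF.le_of_pow_le_pow hD <| e.2.trans <|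
        (usc_le_usc (.of_sub fun t _ => mem_univ t)).trans <|
          (by rw [pow_univ] : usc (univ M) = usc (pow (univ M))) ▸ (usc_pow_equiv (univ M)).1
      obtain ⟨w, hw⟩ := exists_equiv_usc hy
      exact hx w (e.trans (hw.pow.trans (usc_pow_equiv w).symm)).of_usc
    · refine (hD' _).2 (hC.equiv _ _ (hC.step _ (usc z) ((hD' _).1 hy) ?_) (usc_pow_equiv z).symm)
      exact (usc_pow_equiv y).symm.trans e.usc
  have key : usc (univ M) ε C ↔ ¬ univ M ε C := by
    have h1 := notMem (univ M)
    have h2 := mem (univ M)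
    rw [pow_univ] at h1 h2
    exact ⟨h1, h2⟩
  by_cases hV : univ M ε C
  · exact key.1 (usc_mem _ hV) hV
  · obtain ⟨w, e⟩ : ∃ w, Equiv M (univ M) (pow w) := by
      by_contra! h
      exact hV (hC.base _ h)
    have hw : usc w ε C := mem w fun h => hV (hC.equiv _ _ h e.symm)
    have h1 : ¬ pow (usc w) ε C := notMem (usc w) (usc_mem _ hw)
    exact h1 (hC.equiv _ _ (key.2 hV) (e.usc.trans (usc_pow_equiv w)))

end

section

/-! ### Type-level ordered pairs -/

set_option synthInstance.maxHeartbeats 200000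
set_option synthInstance.maxSize 2000

variable (M : Type u) [NFModel M] {α : Type u} [Context M α]

local notation:50 x:51 " ε " y:51 => NFModel.mem (M := M) x y

theorem exists_shift : ∃ g z : M, IsInjective M g ∧ (∀ a, ∃ b, App M g a b) ∧ ∀ a, ¬ App M g a z := by
  have := not_dedekindFinite M
  unfold DedekindFinite at this
  push Not at this
  obtain ⟨g, h1, h2, z, h3⟩ := this
  exact ⟨g, z, h1, h2, h3⟩

/-- An injection of the universe into itself which is not surjective. -/
noncomputable def shift : M := (exists_shift M).choose

/-- An element outside the range of `shift`. -/
noncomputable def basePoint : M := (exists_shift M).choose_spec.choose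

theorem isInjective_shift : IsInjective M (shift M) := (exists_shift M).choose_spec.choose_spec.1

theorem exists_app_shift (a : M) : ∃ b, App M (shift M) a b :=
  (exists_shift M).choose_spec.choose_spec.2.1 a

theorem not_app_shift (a : M) : ¬ App M (shift M) a (basePoint M) :=
  (exists_shift M).choose_spec.choose_spec.2.2 a

/-- `x` is the image of `y` under `shift`. -/
def IsShift (x y : M) : Prop := ∀ t : M, t ε x ↔ ∃ u : M, u ε y ∧ App M (shift M) u t

/-- `x` consists of the image of `y` under `shift` and of the base point. -/
def IsPointedShift (x y : M) : Prop :=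
  ∀ t : M, t ε x ↔ (t = basePoint M ∨ ∃ u : M, u ε y ∧ App M (shift M) u t)

/-- `p` is the type-level (Quine) ordered pair of `a` and `b`. -/
def IsQPair (p a b : M) : Prop :=
  ∀ x : M, x ε p ↔ ((∃ y : M, y ε a ∧ IsShift M x y) ∨ ∃ y : M, y ε b ∧ IsPointedShift M x y)

variable {M}

namespace Stratified

variable {k : ℕ}

instance isShift (x y : α → Typed M (k + 1)) [IsTerm x] [IsTerm y] :
    Stratified M (fun w => IsShift M (x w) (y w)) :=
  inferInstanceAs (Stratified M (fun w => ∀ t : Typed M k, t ε x w ↔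
    ∃ u : Typed M k, u ε y w ∧ App M (up (k + 3) (shift M)) u t))

instance isPointedShift (x y : α → Typed M (k + 1)) [IsTerm x] [IsTerm y] :
    Stratified M (fun w => IsPointedShift M (x w) (y w)) :=
  inferInstanceAs (Stratified M (fun w => ∀ t : Typed M k, t ε x w ↔ (t = up k (basePoint M) ∨
    ∃ u : Typed M k, u ε y w ∧ App M (up (k + 3) (shift M)) u t)))

instance isQPair (p a b : α → Typed M (k + 2)) [IsTerm p] [IsTerm a] [IsTerm b] :
    Stratified M (fun w => IsQPair M (p w) (a w) (b w)) :=
  inferInstanceAs (Stratified M (fun w => ∀ x : Typed M (k + 1), x ε p w ↔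
    ((∃ y : Typed M (k + 1), y ε a w ∧ IsShift M x y) ∨
      ∃ y : Typed M (k + 1), y ε b w ∧ IsPointedShift M x y)))

end Stratified

theorem exists_qPair (a b : M) : ∃ p, IsQPair M p a b :=
  exists_set M (fun x : Typed M 1 => (∃ y : Typed M 1, y ε up 2 a ∧ IsShift M x y) ∨
    ∃ y : Typed M 1, y ε up 2 b ∧ IsPointedShift M x y)

theorem IsQPair.unique {p p' a b : M} (h : IsQPair M p a b) (h' : IsQPair M p' a b) : p = p' :=
  set_ext fun x => (h x).trans (h' x).symm

theorem IsShift.mem_iff {x y u v : M} (h : IsShift M x y) (huv : App M (shift M) u v) :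
    v ε x ↔ u ε y := by
  refine (h v).trans ⟨?_, fun hu => ⟨u, hu, huv⟩⟩
  rintro ⟨u', hu', h'⟩
  rwa [(isInjective_shift M _ _ _ _ huv h').2 rfl]

theorem IsPointedShift.mem_iff {x y u v : M} (h : IsPointedShift M x y)
    (huv : App M (shift M) u v) : v ε x ↔ u ε y := by
  refine (h v).trans ⟨?_, fun hu => .inr ⟨u, hu, huv⟩⟩
  rintro (rfl | ⟨u', hu', h'⟩)
  · exact (not_app_shift M u huv).elim
  · rwa [(isInjective_shift M _ _ _ _ huv h').2 rfl]

theorem IsShift.inj {x y y' : M} (h : IsShift M x y) (h' : IsShift M x y') : y = y' :=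
  set_ext fun u => by
    obtain ⟨v, hv⟩ := exists_app_shift M u
    rw [← h.mem_iff hv, h'.mem_iff hv]

theorem IsPointedShift.inj {x y y' : M} (h : IsPointedShift M x y) (h' : IsPointedShift M x y') :
    y = y' :=
  set_ext fun u => by
    obtain ⟨v, hv⟩ := exists_app_shift M u
    rw [← h.mem_iff hv, h'.mem_iff hv]

theorem IsShift.not_isPointedShift {x y y' : M} (h : IsShift M x y) : ¬ IsPointedShift M x y' := by
  intro h'
  obtain ⟨u, -, hu⟩ := (h _).1 ((h' _).2 (.inl rfl))
  exact not_app_shift M u hu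

theorem exists_isShift (y : M) : ∃ x, IsShift M x y :=
  exists_set M (fun t : Typed M 0 => ∃ u : Typed M 0, u ε up 1 y ∧ App M (up 3 (shift M)) u t)

theorem exists_isPointedShift (y : M) : ∃ x, IsPointedShift M x y :=
  exists_set M (fun t : Typed M 0 => t = up 0 (basePoint M) ∨
    ∃ u : Typed M 0, u ε up 1 y ∧ App M (up 3 (shift M)) u t)

/-- The base point is a tag: members of the pair containing it code members of the second component,
the others those of the first. -/
theorem IsQPair.inj {p a b a' b' : M} (h : IsQPair M p a b) (h' : IsQPair M p a' b') :
    a = a' ∧ b = b' := by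
  have hl : ∀ {a b : M}, IsQPair M p a b → ∀ {x y : M}, IsShift M x y → (x ε p ↔ y ε a) := by
    refine fun h x y hx => (h x).trans ⟨?_, fun hy => .inl ⟨y, hy, hx⟩⟩
    rintro (⟨z, hz, hxz⟩ | ⟨z, -, hxz⟩)
    · rwa [hx.inj hxz]
    · exact (hx.not_isPointedShift hxz).elim
  have hr : ∀ {a b : M}, IsQPair M p a b → ∀ {x y : M}, IsPointedShift M x y →
      (x ε p ↔ y ε b) := by
    refine fun h x y hx => (h x).trans ⟨?_, fun hy => .inr ⟨y, hy, hx⟩⟩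
    rintro (⟨z, -, hxz⟩ | ⟨z, hz, hxz⟩)
    · exact (hxz.not_isPointedShift hx).elim
    · rwa [hx.inj hxz]
  constructor <;> refine set_ext fun y => ?_
  · obtain ⟨x, hx⟩ := exists_isShift y
    rw [← hl h hx, hl h' hx]
  · obtain ⟨x, hx⟩ := exists_isPointedShift y
    rw [← hr h hx, hr h' hx]

end

namespace NFSet

/-! ### Arrows -/

section

variable {M : Type u} [NFModel M] {A B C : NFSet M}

local notation:50 x:51 " ε " y:51 => NFModel.mem (M := M) x y

/-- The function underlying an arrow. -/
def fn (f : A ⟶ B) : A.Elem → B.Elem := Subtype.val f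

theorem hom_ext {f g : A ⟶ B} (h : ∀ a, fn f a = fn g a) : f = g := Subtype.ext (funext h)

theorem fn_comp (f : A ⟶ B) (g : B ⟶ C) (a : A.Elem) : fn (f ≫ g) a = fn g (fn f a) := rfl

theorem exists_graph (f : A ⟶ B) : ∃ g : M, ∀ a b : M, App M g a b ↔
    ∃ ha : a ε A.carrier, (fn f ⟨a, ha⟩).1 = b := by
  obtain ⟨g, hg⟩ := f.2
  refine ⟨g, fun a b => ⟨?_, ?_⟩⟩
  · rintro ⟨p, hp, hab⟩
    obtain ⟨a', ha'⟩ := (hg p).1 hp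
    obtain ⟨rfl, rfl⟩ := hab.inj ha'
    exact ⟨a'.2, rfl⟩
  · rintro ⟨ha, rfl⟩
    obtain ⟨p, hp⟩ := exists_pair a (fn f ⟨a, ha⟩).1
    exact ⟨p, (hg p).2 ⟨⟨a, ha⟩, hp⟩, hp⟩

/-- The graph of an arrow. -/
noncomputable def graph (f : A ⟶ B) : M := (exists_graph f).choose

theorem app_graph (f : A ⟶ B) (a : A.Elem) (b : M) : App M (graph f) a.1 b ↔ (fn f a).1 = b :=
  ((exists_graph f).choose_spec a.1 b).trans ⟨fun ⟨_, h⟩ => h, fun h => ⟨a.2, h⟩⟩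

theorem app_graph_self (f : A ⟶ B) (a : A.Elem) : App M (graph f) a.1 (fn f a).1 :=
  (app_graph f a _).2 rfl

theorem exists_of_app_graph {f : A ⟶ B} {a b : M} (h : App M (graph f) a b) :
    ∃ x : A.Elem, x.1 = a ∧ (fn f x).1 = b :=
  have ⟨ha, h⟩ := ((exists_graph f).choose_spec a b).1 h
  ⟨⟨a, ha⟩, rfl, h⟩

/-- Elements get type 2, the lowest at which `IsQPair` is stratified; objects then enter at type 3
and graphs at type 5. -/
theorem exists_hom (R : Typed M 2 → Typed M 2 → Prop)
    [Stratified M (fun a : ((PUnit.{u + 1} × Typed M 4) × Typed M 2) × Typed M 2 => R a.1.2 a.2)]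
    (h : ∀ a : A.Elem, ∃ b : B.Elem, ∀ c : M, R a.1 c ↔ c = b.1) :
    ∃ f : A ⟶ B, ∀ (a : A.Elem) (c : M), R a.1 c ↔ c = (fn f a).1 := by
  choose f hf using h
  obtain ⟨g, hg⟩ := exists_set M (fun z : Typed M 4 => ∃ a b : Typed M 2,
    IsPair (M := M) z a b ∧ a ε up 3 A.carrier ∧ R a b)
  refine ⟨⟨f, g, fun z => (hg z).trans ⟨?_, ?_⟩⟩, hf⟩
  · rintro ⟨a, b, hz, ha, hab⟩
    obtain rfl := (hf ⟨a, ha⟩ b).1 hab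
    exact ⟨⟨a, ha⟩, hz⟩
  · rintro ⟨a, hz⟩
    exact ⟨a.1, (f a).1, hz, a.2, (hf a _).2 rfl⟩

theorem exists_inclusion (h : ∀ x : M, x ε A.carrier → x ε B.carrier) :
    ∃ i : A ⟶ B, ∀ a, (fn i a).1 = a.1 := by
  obtain ⟨i, hi⟩ := exists_hom (A := A) (B := B) (fun a b => a = b) fun a =>
    ⟨⟨a.1, h _ a.2⟩, fun c => eq_comm⟩
  exact ⟨i, fun a => ((hi a _).2 rfl).symm⟩

theorem exists_const (A : NFSet M) (b : B.Elem) : ∃ f : A ⟶ B, ∀ a, fn f a = b := by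
  obtain ⟨f, hf⟩ := exists_hom (A := A) (B := B) (fun _ y => y = up 2 b.1) fun a =>
    ⟨b, fun c => Iff.rfl⟩
  exact ⟨f, fun a => Subtype.ext ((hf a _).2 rfl)⟩

variable (M) in
/-- A set with exactly one member. -/
noncomputable def point : NFSet M := ⟨sing (NewFoundations.empty M)⟩

theorem point_subsingleton (x y : (point M).Elem) : x = y :=
  Subtype.ext ((mem_sing.1 x.2).trans (mem_sing.1 y.2).symm)

variable (M) in
/-- The member of `point M`. -/
noncomputable def pointElem : (point M).Elem := ⟨_, mem_sing.2 rfl⟩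

/-- The arrow from the one-point set that names an element. -/
noncomputable def name (b : B.Elem) : point M ⟶ B := (exists_const (point M) b).choose

theorem fn_name (b : B.Elem) (x) : fn (name b) x = b := (exists_const (point M) b).choose_spec x

/-- Elements are arrows from the one-point set, so a mono separates them. -/
theorem fn_injective (f : A ⟶ B) [Mono f] : Function.Injective (fn f) := by
  intro a a' h
  have : name a = name a' := by
    rw [← cancel_mono f]
    exact hom_ext fun x => by rw [fn_comp, fn_comp, fn_name, fn_name, h]
  rw [← fn_name a (pointElem M), this, fn_name]

theorem mono_of_injective {f : A ⟶ B} (h : Function.Injective (fn f)) : Mono f :=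
  ⟨fun _ _ e => hom_ext fun x => h (congrArg (fun k => fn k x) e)⟩

/-- A pair of arrows induces an arrow into a set with a jointly injective pair of arrows. -/
theorem exists_lift {P W : NFSet M} (p : P ⟶ A) (q : P ⟶ B) (s : W ⟶ A) (t : W ⟶ B)
    (inj : ∀ x y, fn p x = fn p y → fn q x = fn q y → x = y)
    (h : ∀ w, ∃ x, fn p x = fn s w ∧ fn q x = fn t w) : ∃ k : W ⟶ P, k ≫ p = s ∧ k ≫ q = t := by
  obtain ⟨k, hk⟩ := exists_hom (A := W) (B := P) (fun w x => ∃ a b : Typed M 2,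
    App M (up 5 (graph s)) w a ∧ App M (up 5 (graph t)) w b ∧ App M (up 5 (graph p)) x a ∧
      App M (up 5 (graph q)) x b) fun w => by
      obtain ⟨x, hx, hx'⟩ := h w
      refine ⟨x, fun y => ⟨?_, ?_⟩⟩
      · rintro ⟨a, b, h1, h2, h3, h4⟩
        obtain ⟨y, rfl, rfl⟩ := exists_of_app_graph h3
        exact congrArg Subtype.val (inj y x
          (Subtype.ext (((app_graph _ _ _).1 h1).symm.trans (congrArg Subtype.val hx.symm)))
          (Subtype.ext (((app_graph _ _ _).1 h4).trans
            (((app_graph _ _ _).1 h2).symm.trans (congrArg Subtype.val hx'.symm)))))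
      · rintro rfl
        exact ⟨(fn s w).1, (fn t w).1, app_graph_self s w, app_graph_self t w,
          (app_graph _ _ _).2 (congrArg Subtype.val hx), (app_graph _ _ _).2 (congrArg Subtype.val hx')⟩
  refine ⟨k, hom_ext fun w => ?_, hom_ext fun w => ?_⟩ <;>
    obtain ⟨a, b, h1, h2, h3, h4⟩ := (hk w _).2 rfl
  · exact Subtype.ext (((app_graph _ _ _).1 h3).trans ((app_graph _ _ _).1 h1).symm)
  · exact Subtype.ext (((app_graph _ _ _).1 h4).trans ((app_graph _ _ _).1 h2).symm)

theorem exists_factorization {W : NFSet M} (m : A ⟶ B) (hm : Function.Injective (fn m)) (s : W ⟶ B)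
    (h : ∀ w, ∃ x, fn m x = fn s w) : ∃ k : W ⟶ A, k ≫ m = s := by
  obtain ⟨k, hk, -⟩ := exists_lift m m s s (fun x y h _ => hm h) fun w =>
    (h w).imp fun x hx => ⟨hx, hx⟩
  exact ⟨k, hk⟩

/-- Descent along a surjection. -/
theorem exists_desc {W : NFSet M} (e : A ⟶ B) (he : Function.Surjective (fn e)) (s : A ⟶ W)
    (h : ∀ x y, fn e x = fn e y → fn s x = fn s y) : ∃ k : B ⟶ W, e ≫ k = s := by
  obtain ⟨k, hk⟩ := exists_hom (A := B) (B := W) (fun b w => ∃ a : Typed M 2,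
    App M (up 5 (graph e)) a b ∧ App M (up 5 (graph s)) a w) fun b => by
    obtain ⟨a, rfl⟩ := he b
    refine ⟨fn s a, fun w => ⟨?_, ?_⟩⟩
    · rintro ⟨x, h1, h2⟩
      obtain ⟨x, rfl, hx⟩ := exists_of_app_graph h1
      rw [← (app_graph s x w).1 h2, h x a (Subtype.ext hx)]
    · rintro rfl
      exact ⟨a.1, app_graph_self e a, app_graph_self s a⟩
  exact ⟨k, hom_ext fun a => Subtype.ext
    ((hk (fn e a) _).1 ⟨a.1, app_graph_self e a, app_graph_self s a⟩).symm⟩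

theorem epi_of_surjective {f : A ⟶ B} (h : Function.Surjective (fn f)) : Epi f :=
  ⟨fun _ _ e => hom_ext fun y => by
    obtain ⟨x, rfl⟩ := h y
    exact congrArg (fun k => fn k x) e⟩

/-- The image of an arrow. -/
theorem exists_image_factorization (f : A ⟶ B) : ∃ (I : NFSet M) (e : A ⟶ I) (m : I ⟶ B),
    Function.Surjective (fn e) ∧ Function.Injective (fn m) ∧ e ≫ m = f := by
  obtain ⟨I, hI⟩ := exists_set M (fun b : Typed M 2 => ∃ a : Typed M 2,
    App M (up 5 (graph f)) a b)
  have hI' : ∀ x : M, x ε I ↔ ∃ a, (fn f a).1 = x := fun x => (hI x).trans ⟨fun ⟨a, ha⟩ =>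
    have ⟨a', _, h⟩ := exists_of_app_graph ha
    ⟨a', h⟩, fun ⟨a, h⟩ => ⟨a.1, (app_graph f a x).2 h⟩⟩
  obtain ⟨m, hm⟩ := exists_inclusion (A := ⟨I⟩) (B := B) fun x hx => by
    obtain ⟨a, rfl⟩ := (hI' x).1 hx
    exact (fn f a).2
  have hm' : Function.Injective (fn m) := fun x y h => Subtype.ext (by rw [← hm, h, hm])
  obtain ⟨e, he⟩ := exists_factorization m hm' f fun a =>
    ⟨⟨(fn f a).1, (hI' _).2 ⟨a, rfl⟩⟩, Subtype.ext (hm _)⟩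
  refine ⟨⟨I⟩, e, m, fun x => ?_, hm', he⟩
  obtain ⟨a, ha⟩ := (hI' x.1).1 x.2
  exact ⟨a, hm' (Subtype.ext (by rw [← fn_comp, he, ha, hm]))⟩

/-! ### Limits and colimits -/

theorem isPullback_of_elements {P : NFSet M} {p : P ⟶ A} {q : P ⟶ B} {f : A ⟶ C} {g : B ⟶ C}
    (w : p ≫ f = q ≫ g) (inj : ∀ x y, fn p x = fn p y → fn q x = fn q y → x = y)
    (h : ∀ a b, fn f a = fn g b → ∃ x, fn p x = a ∧ fn q x = b) : IsPullback p q f g := by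
  have H : ∀ s : PullbackCone f g, ∃ k, k ≫ p = s.fst ∧ k ≫ q = s.snd := fun s =>
    exists_lift p q s.fst s.snd inj fun x => h _ _ (congrArg (fun k => fn k x) s.condition)
  exact ⟨⟨w⟩, ⟨PullbackCone.IsLimit.mk w (fun s => (H s).choose) (fun s => (H s).choose_spec.1)
    (fun s => (H s).choose_spec.2) fun s k hk hk' => hom_ext fun x =>
      inj _ _ (congrArg (fun k => fn k x) (hk.trans (H s).choose_spec.1.symm))
        (congrArg (fun k => fn k x) (hk'.trans (H s).choose_spec.2.symm))⟩⟩

theorem exists_elem_of_isPullback {P : NFSet M} {p : P ⟶ A} {q : P ⟶ B} {f : A ⟶ C} {g : B ⟶ C}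
    (h : IsPullback p q f g) {a : A.Elem} {b : B.Elem} (hab : fn f a = fn g b) :
    ∃ x, fn p x = a ∧ fn q x = b := by
  have w : name a ≫ f = name b ≫ g :=
    hom_ext fun x => by rw [fn_comp, fn_comp, fn_name, fn_name, hab]
  refine ⟨fn (h.lift _ _ w) (pointElem M), ?_, ?_⟩
  · rw [← fn_comp, h.lift_fst, fn_name]
  · rw [← fn_comp, h.lift_snd, fn_name]

/-- Quine pairs have the type of their components, so both projections are arrows. -/
theorem exists_isPullback (f : A ⟶ C) (g : B ⟶ C) :
    ∃ (P : NFSet M) (p : P ⟶ A) (q : P ⟶ B), IsPullback p q f g := by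
  obtain ⟨P, hP⟩ := exists_set M (fun p : Typed M 2 => ∃ a b c : Typed M 2, IsQPair M p a b ∧
    App M (up 5 (graph f)) a c ∧ App M (up 5 (graph g)) b c)
  replace hP : ∀ x : M, x ε P ↔ ∃ a b, IsQPair M x a.1 b.1 ∧ fn f a = fn g b := by
    refine fun x => (hP x).trans ⟨?_, ?_⟩
    · rintro ⟨a, b, c, h1, h2, h3⟩
      obtain ⟨a, rfl, rfl⟩ := exists_of_app_graph h2
      obtain ⟨b, rfl, h⟩ := exists_of_app_graph h3
      exact ⟨a, b, h1, Subtype.ext h.symm⟩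
    · rintro ⟨a, b, h1, h2⟩
      exact ⟨a.1, b.1, (fn f a).1, h1, app_graph_self f a, h2 ▸ app_graph_self g b⟩
  obtain ⟨p, hp⟩ := exists_hom (A := ⟨P⟩) (B := A) (fun x a => ∃ b : Typed M 2,
    b ε up 3 B.carrier ∧ IsQPair M x a b) fun x => by
      obtain ⟨a, b, h, -⟩ := (hP x.1).1 x.2
      exact ⟨a, fun c => ⟨fun ⟨d, _, hd⟩ => (hd.inj h).1, fun e => ⟨b.1, b.2, e ▸ h⟩⟩⟩
  obtain ⟨q, hq⟩ := exists_hom (A := ⟨P⟩) (B := B) (fun x b => ∃ a : Typed M 2, IsQPair M x a b)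
    fun x => by
      obtain ⟨a, b, h, -⟩ := (hP x.1).1 x.2
      exact ⟨b, fun c => ⟨fun ⟨d, hd⟩ => (hd.inj h).2, fun e => ⟨a.1, e ▸ h⟩⟩⟩
  have key : ∀ (x : (NFSet.mk P).Elem) (a : A.Elem) (b : B.Elem), IsQPair M x.1 a.1 b.1 →
      (fn p x).1 = a.1 ∧ (fn q x).1 = b.1 :=
    fun x a b h => ⟨((hp x a.1).1 ⟨b.1, b.2, h⟩).symm, ((hq x b.1).1 ⟨a.1, h⟩).symm⟩
  refine ⟨⟨P⟩, p, q, isPullback_of_elements (hom_ext fun x => ?_) (fun x y h h' => ?_)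
    fun a b h => ?_⟩
  · obtain ⟨a, b, h, e⟩ := (hP x.1).1 x.2
    obtain ⟨h1, h2⟩ := key x _ _ h
    rw [fn_comp, fn_comp, Subtype.ext h1, Subtype.ext h2, e]
  · obtain ⟨a, b, hx, -⟩ := (hP x.1).1 x.2
    obtain ⟨a', b', hy, -⟩ := (hP y.1).1 y.2
    obtain ⟨h1, h2⟩ := key x _ _ hx
    obtain ⟨h3, h4⟩ := key y _ _ hy
    rw [← h1, ← h2] at hx
    rw [← h3, ← h4, ← h, ← h'] at hy
    exact Subtype.ext (hx.unique hy)
  · obtain ⟨x, hx⟩ := exists_qPair a.1 b.1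
    have := key ⟨x, (hP x).2 ⟨a, b, hx, h⟩⟩ _ _ hx
    exact ⟨_, Subtype.ext this.1, Subtype.ext this.2⟩

instance hasPullbacks : HasPullbacks (NFSet M) :=
  @hasPullbacks_of_hasLimit_cospan _ _ fun {_ _ _ f g} =>
    (exists_isPullback f g).choose_spec.choose_spec.choose_spec.hasPullback

instance hasTerminal : HasTerminal (NFSet M) :=
  @hasTerminal_of_unique _ _ (point M)
    (fun A => ⟨(exists_const A (pointElem M)).choose⟩)
    fun _ => ⟨fun _ _ => hom_ext fun _ => point_subsingleton _ _⟩

instance hasFiniteLimits : HasFiniteLimits (NFSet M) := hasFiniteLimits_of_hasTerminal_and_pullbacks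

instance hasInitial : HasInitial (NFSet M) :=
  @hasInitial_of_unique _ _ ⟨NewFoundations.empty M⟩
    (fun _ => ⟨(exists_inclusion fun x hx => (notMem_empty x hx).elim).choose⟩)
    fun _ => ⟨fun _ _ => hom_ext fun x => (notMem_empty x.1 x.2).elim⟩

theorem exists_coproduct (A B : NFSet M) : ∃ (S : NFSet M) (i : A ⟶ S) (j : B ⟶ S),
    (∀ x, (∃ a, fn i a = x) ∨ ∃ b, fn j b = x) ∧ ∀ (W : NFSet M) (s : A ⟶ W) (t : B ⟶ W),
      ∃ k : S ⟶ W, i ≫ k = s ∧ j ≫ k = t := by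
  -- ∅ and V serve as two distinct tags for the disjoint union.
  set o := NewFoundations.empty M with ho
  set v := univ M with hv
  have hne : o ≠ v := fun e => notMem_empty o (ho ▸ e ▸ mem_univ o)
  obtain ⟨S, hS⟩ := exists_set M (fun p : Typed M 2 =>
    (∃ a : Typed M 2, a ε up 3 A.carrier ∧ IsQPair M p a (up 2 o)) ∨
      ∃ b : Typed M 2, b ε up 3 B.carrier ∧ IsQPair M p b (up 2 v))
  obtain ⟨i, hi⟩ := exists_hom (A := A) (B := ⟨S⟩) (fun a p => IsQPair M p a (up 2 o)) fun a => by
    obtain ⟨p, hp⟩ := exists_qPair a.1 o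
    exact ⟨⟨p, (hS p).2 (.inl ⟨a.1, a.2, hp⟩)⟩, fun c => ⟨fun h => h.unique hp, fun h => h ▸ hp⟩⟩
  obtain ⟨j, hj⟩ := exists_hom (A := B) (B := ⟨S⟩) (fun b p => IsQPair M p b (up 2 v)) fun b => by
    obtain ⟨p, hp⟩ := exists_qPair b.1 v
    exact ⟨⟨p, (hS p).2 (.inr ⟨b.1, b.2, hp⟩)⟩, fun c => ⟨fun h => h.unique hp, fun h => h ▸ hp⟩⟩
  have hi' : ∀ a, IsQPair M (fn i a).1 a.1 o := fun a => (hi a _).2 rfl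
  have hj' : ∀ b, IsQPair M (fn j b).1 b.1 v := fun b => (hj b _).2 rfl
  have cases : ∀ x, (∃ a, fn i a = x) ∨ ∃ b, fn j b = x := by
    intro x
    obtain ⟨a, ha, h⟩ | ⟨b, hb, h⟩ := (hS x.1).1 x.2
    · exact .inl ⟨⟨a, ha⟩, Subtype.ext ((hi' ⟨a, ha⟩).unique h)⟩
    · exact .inr ⟨⟨b, hb⟩, Subtype.ext ((hj' ⟨b, hb⟩).unique h)⟩
  refine ⟨⟨S⟩, i, j, cases, fun W s t => ?_⟩
  obtain ⟨k, hk⟩ := exists_hom (A := ⟨S⟩) (B := W) (fun x w =>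
    (∃ a : Typed M 2, IsQPair M x a (up 2 o) ∧ App M (up 5 (graph s)) a w) ∨
      ∃ b : Typed M 2, IsQPair M x b (up 2 v) ∧ App M (up 5 (graph t)) b w) fun x => by
    obtain ⟨a, rfl⟩ | ⟨b, rfl⟩ := cases x
    · refine ⟨fn s a, fun c => ⟨?_, ?_⟩⟩
      · rintro (⟨a', h, h'⟩ | ⟨b', h, -⟩)
        · obtain rfl := (h.inj (hi' a)).1
          exact ((app_graph s a c).1 h').symm
        · exact (hne (h.inj (hi' a)).2.symm).elim
      · rintro rfl
        exact .inl ⟨a.1, hi' a, app_graph_self s a⟩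
    · refine ⟨fn t b, fun c => ⟨?_, ?_⟩⟩
      · rintro (⟨a', h, -⟩ | ⟨b', h, h'⟩)
        · exact (hne (h.inj (hj' b)).2).elim
        · obtain rfl := (h.inj (hj' b)).1
          exact ((app_graph t b c).1 h').symm
      · rintro rfl
        exact .inr ⟨b.1, hj' b, app_graph_self t b⟩
  exact ⟨k, hom_ext fun a => Subtype.ext ((hk _ _).1 (.inl ⟨a.1, hi' a, app_graph_self s a⟩)).symm,
    hom_ext fun b => Subtype.ext ((hk _ _).1 (.inr ⟨b.1, hj' b, app_graph_self t b⟩)).symm⟩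

instance hasBinaryCoproducts : HasBinaryCoproducts (NFSet M) :=
  @hasBinaryCoproducts_of_hasColimit_pair _ _ fun {A B} => by
    obtain ⟨S, i, j, h, h'⟩ := exists_coproduct A B
    refine ⟨⟨⟨BinaryCofan.mk i j, BinaryCofan.IsColimit.mk _ (fun s t => (h' _ s t).choose)
      (fun s t => (h' _ s t).choose_spec.1) (fun s t => (h' _ s t).choose_spec.2)
      fun s t m hm hm' => hom_ext fun x => ?_⟩⟩⟩
    obtain ⟨a, rfl⟩ | ⟨b, rfl⟩ := h x
    · exact congrArg (fun k => fn k a) (hm.trans (h' _ s t).choose_spec.1.symm)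
    · exact congrArg (fun k => fn k b) (hm'.trans (h' _ s t).choose_spec.2.symm)

/-! ### Regular epimorphisms -/

theorem nonempty_isColimit_of_surjective {K : NFSet M} {p q : K ⟶ A} {e : A ⟶ B}
    (he : Function.Surjective (fn e)) (w : p ≫ e = q ≫ e)
    (h : ∀ x y, fn e x = fn e y → ∃ z, fn p z = x ∧ fn q z = y) :
    Nonempty (IsColimit (Cofork.ofπ e w)) := by
  have H : ∀ s : Cofork p q, ∃ k, e ≫ k = s.π := fun s => exists_desc e he s.π fun x y hxy => by
    obtain ⟨z, rfl, rfl⟩ := h x y hxy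
    exact congrArg (fun k => fn k z) s.condition
  have := epi_of_surjective he
  exact ⟨Cofork.IsColimit.mk _ (fun s => (H s).choose) (fun s => (H s).choose_spec)
    fun s m hm => (cancel_epi e).1 (hm.trans (H s).choose_spec.symm)⟩

/-- If f is a coequalizer with image factorization e ≫ m, then e also coequalizes the pair, and its
factor through f is a section of m; so m is onto. Conversely, a surjection is the coequalizer of its
kernel pair. -/
theorem isRegularEpi_iff_surjective (f : A ⟶ B) :
    IsRegularEpi f ↔ Function.Surjective (fn f) := by
  constructor
  · rintro ⟨⟨r⟩⟩
    obtain ⟨I, e, m, he, hm, rfl⟩ := exists_image_factorization f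
    have := mono_of_injective hm
    have w : r.left ≫ e = r.right ≫ e := by
      rw [← cancel_mono m, Category.assoc, Category.assoc, r.w]
    obtain ⟨d, hd⟩ := Cofork.IsColimit.desc' r.isColimit e w
    have hd' : (e ≫ m) ≫ d = e := hd
    have hdm : d ≫ m = 𝟙 B := Cofork.IsColimit.hom_ext r.isColimit (by
      change (e ≫ m) ≫ d ≫ m = (e ≫ m) ≫ 𝟙 B
      rw [← Category.assoc, hd', Category.comp_id])
    intro b
    obtain ⟨a, ha⟩ := he (fn d b)
    exact ⟨a, by rw [fn_comp, ha, ← fn_comp, hdm]; rfl⟩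
  · intro hf
    obtain ⟨K, p, q, h⟩ := exists_isPullback f f
    obtain ⟨hc⟩ := nonempty_isColimit_of_surjective hf h.w fun x y hxy =>
      exists_elem_of_isPullback h hxy
    exact ⟨⟨⟨K, p, q, h.w, hc⟩⟩⟩

/-! ### Subobjects -/

/-- The elements of `A` that belong to a subobject. -/
def members (P : Subobject A) : Set A.Elem := Set.range (fn P.arrow)

theorem le_iff_members_subset {P Q : Subobject A} : P ≤ Q ↔ members P ⊆ members Q := by
  constructor
  · rintro h _ ⟨x, rfl⟩
    exact ⟨fn (P.ofLE Q h) x, by rw [← fn_comp, Subobject.ofLE_arrow]⟩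
  · intro h
    obtain ⟨k, hk⟩ := exists_factorization Q.arrow (fn_injective _) P.arrow fun w => h ⟨w, rfl⟩
    exact Subobject.le_of_comm k hk

theorem members_pullback (f : A ⟶ B) (P : Subobject B) :
    members ((Subobject.pullback f).obj P) = fn f ⁻¹' members P := by
  have h := Subobject.isPullback f P
  refine Set.Subset.antisymm ?_ ?_
  · rintro _ ⟨x, rfl⟩
    exact ⟨fn (Subobject.pullbackπ f P) x, congrArg (fun k => fn k x) h.w⟩
  · rintro a ⟨y, hy⟩
    obtain ⟨x, -, hx⟩ := exists_elem_of_isPullback h hy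
    exact ⟨x, hx⟩

theorem exists_subobject (S : M) (h : ∀ x : M, x ε S → x ε A.carrier) :
    ∃ P : Subobject A, ∀ a, a ∈ members P ↔ a.1 ε S := by
  obtain ⟨i, hi⟩ := exists_inclusion (A := ⟨S⟩) (B := A) h
  have := mono_of_injective (f := i) fun x y h => Subtype.ext (by rw [← hi, h, hi])
  have h1 : ∀ x, fn (Subobject.mk i).arrow x = fn i (fn (Subobject.underlyingIso i).hom x) :=
    fun x => by rw [← fn_comp, Subobject.underlyingIso_hom_comp_eq_mk]
  have h2 : ∀ x, fn (Subobject.mk i).arrow (fn (Subobject.underlyingIso i).inv x) = fn i x :=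
    fun x => by rw [← fn_comp, Subobject.underlyingIso_arrow]
  refine ⟨Subobject.mk i, fun a => ⟨?_, fun ha => ?_⟩⟩
  · rintro ⟨x, rfl⟩
    rw [h1, hi]
    exact (fn (Subobject.underlyingIso i).hom x).2
  · exact ⟨_, (h2 ⟨a.1, ha⟩).trans (Subtype.ext (hi _))⟩

theorem exists_dualImage (f : A ⟶ B) (P : Subobject A) :
    ∃ Q : Subobject B, ∀ b, b ∈ members Q ↔ ∀ a, fn f a = b → a ∈ members P := by
  obtain ⟨S, hS⟩ := exists_set M (fun b : Typed M 2 => b ε up 3 B.carrier ∧ ∀ a : Typed M 2,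
    App M (up 5 (graph f)) a b → ∃ x : Typed M 2, App M (up 5 (graph P.arrow)) x a)
  obtain ⟨Q, hQ⟩ := exists_subobject S fun x hx => ((hS x).1 hx).1
  refine ⟨Q, fun b => ((hQ b).trans (hS b.1)).trans ⟨?_, fun h => ⟨b.2, fun a ha => ?_⟩⟩⟩
  · rintro ⟨-, h⟩ a rfl
    obtain ⟨x, hx⟩ := h a.1 (app_graph_self f a)
    obtain ⟨x, -, hx⟩ := exists_of_app_graph hx
    exact ⟨x, Subtype.ext hx⟩
  · obtain ⟨a, rfl, hab⟩ := exists_of_app_graph ha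
    obtain ⟨x, rfl⟩ := h a (Subtype.ext hab)
    exact ⟨x.1, app_graph_self _ x⟩

theorem isLeftAdjoint_pullback (f : A ⟶ B) : (Subobject.pullback f).IsLeftAdjoint := by
  choose g hg using exists_dualImage f
  have gc : GaloisConnection (Subobject.pullback f).obj g := fun Q P => by
    rw [le_iff_members_subset, le_iff_members_subset, members_pullback]
    constructor
    · intro h b hb
      refine (hg P b).2 ?_
      rintro a rfl
      exact h hb
    · exact fun h a ha => (hg P _).1 (h ha) a rfl
  exact ⟨_, ⟨(Adjunction.mkOfHomEquiv
    { homEquiv := fun Q P => ⟨fun h => homOfLE (gc.le_u h.le), fun h => homOfLE (gc.l_le h.le),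
        fun _ => Subsingleton.elim _ _, fun _ => Subsingleton.elim _ _⟩ } :
      Subobject.pullback f ⊣ gc.monotone_u.functor)⟩⟩

end

end NFSet

end NewFoundations

/-! ### The theorem -/

theorem mainTheorem8 (M : Type u) [NewFoundations.NFModel M] :
    NewFoundations.CategoryOfClasses (NewFoundations.NFSet M) where
  finiteCoproducts := hasFiniteCoproducts_of_has_binary_and_initial
  kernelQuotients := by
    intro X Y Z f p q h
    -- As m is mono, e identifies the same pairs as f, so the given kernel pair has e as its
    -- coequalizer.
    obtain ⟨I, e, m, he, hm, rfl⟩ := NewFoundations.NFSet.exists_image_factorization f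
    have := NewFoundations.NFSet.mono_of_injective hm
    have w : p ≫ e = q ≫ e := by rw [← cancel_mono m, Category.assoc, Category.assoc, h.w]
    obtain ⟨hc⟩ := NewFoundations.NFSet.nonempty_isColimit_of_surjective he w fun x y hxy =>
      NewFoundations.NFSet.exists_elem_of_isPullback h (congrArg (NewFoundations.NFSet.fn m) hxy)
    exact ⟨⟨⟨_, hc⟩⟩⟩
  regularEpi_stable := by
    refine ⟨fun {X Y Y' S f g f' g'} sq hg => ?_⟩
    rw [MorphismProperty.regularEpi_iff, NewFoundations.NFSet.isRegularEpi_iff_surjective] at hg ⊢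
    intro x
    obtain ⟨y, hy⟩ := hg (NewFoundations.NFSet.fn f x)
    obtain ⟨z, -, hz⟩ := NewFoundations.NFSet.exists_elem_of_isPullback sq hy
    exact ⟨z, hz⟩
  dualImages := NewFoundations.NFSet.isLeftAdjoint_pullback
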